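/- Let $n,T\ge 1$ and $m\ge 0$ be integers and let $\mathcal S=\{u\in\mathbb Z_{\ge0}^n:\sum_i u_i\le m\}$, $S=|\mathcal S|$. Let $G$ be the directed graph with a source $s=(0,0)$, nodes $(i,j)$ for $1\le i\le n$, $0\le j\le m$, and a destination $d$; its edges are $(i-1,j)\to(i,j')$ for $j\le j'$ (with $j=0$ if $i=1$), and the auxiliary edges $(n,j)\to d$. Let $\mathcal E$ be the set of all edges and $E=|\mathcal E|=(m+1)[(m+2)(n-1)+4]/2$. An allocation $u\in\mathcal S$ is identified with the $s$–$d$ path through the nodes $(i,u_1+\dots+u_i)$, and with the vector in $\{0,1\}^{E}$ that marks the $n$ non-auxiliary edges of this path. For a probability distribution $p$ on $\mathcal S$ put $C(p)=\mathbb E_{u\sim p}[uu^{\top}]$. Let $\mu$ be a probability distribution on $\mathcal S$ whose support spans the same linear space as $\mathcal S\subseteq\mathbb R^E$, let $\lambda^*$ be the smallest nonzero eigenvalue of $C(\mu)$, and let $$\eta=\sqrt{\frac{\ln S}{\left(\frac{n}{E\lambda^*}+1\right)E\,T^{2/3}}},\qquad \gamma=\frac{n}{\lambda^*}\,\eta ,$$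 where $\gamma\le 1$ is assumed. The algorithm Edge$(\mu)$ starts with the edge weights $w^1_e=1$. In each round $t=1,\dots,T$ the adversary selects a vector $l_t\in\mathbb R^E$, possibly at random and depending on the past, such that $r_t(u):=l_t^{\top}u\in[0,1]$ for all $u\in\mathcal S$. The learner samples $u_t\in\mathcal S$ from $p_t=(1-\gamma)q_t+\gamma\mu$, where $q_t(u)$ is proportional to the product of the weights $w^t_e$ over the edges $e$ of the path of $u$; given the past and $l_t$, the conditional law of $u_t$ is $p_t$. The learner observes only $r_t(u_t)$, computes $\hat l_t=r_t(u_t)\,C(p_t)^{+}u_t$ with the Moore–Penrose inverse, and puts $w^{t+1}_e=w^t_e\exp(\eta\,\hat l_{t,e})$ for the non-auxiliary edges; the weights of the auxiliary edges stay equal to $1$. Then there are absolute constants $C_1,C_2>0$ (independent of $n,m,T,\mu,\delta$ and the adversary) such that for every $\delta\in(0,1)$, with probability at least $1-C_1\delta$, $$\max_{u\in\mathcal S}\sum_{t=1}^T r_t(u)-\sum_{t=1}^T r_t(u_t)\;\le\; C_2\,T^{2/3}\sqrt{\left(\frac{n}{E\lambda^*}+1\right)E\,\ln(S/\delta)} .$$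 In particular this holds for the Colonel Blotto game with battlefield weights $b_i>0$, $\sum_i b_i=1$, and any sequence of opponent allocations $v_t\in\mathbb Z_{\ge0}^n$ (for instance i.i.d. from an unknown distribution), where $r_t(u)=\sum_i b_i\left(\mathbf 1_{\{u_i>v_{t,i}\}}+\tfrac12\mathbf 1_{\{u_i=v_{t,i}\}}\right)$. -/

import Mathlib

open MeasureTheory

namespace ColonelBlotto

/-- The fixed action set: allocations of at most `m` troops to `n` battlefields. -/
abbrev Strategy (n m : ℕ) : Type :=
  {u : Fin n → Fin (m + 1) // ∑ i, (u i : ℕ) ≤ m}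

/-- Payoff of allocation `u` against `v`: battlefield `i` is worth `b i`, and ties are shared. -/
noncomputable def payoff {n m : ℕ} (b : Fin n → ℝ) (u : Strategy n m) (v : Fin n → ℕ) : ℝ :=
  ∑ i, b i * (if v i < (u.1 i : ℕ) then 1 else if (u.1 i : ℕ) = v i then 1 / 2 else 0)

/-- Nodes of the layered graph: the source (layer `0`), the nodes `inner i j` of layer `i + 1`
(meaning that `j` troops have been spent on the battlefields `0, …, i`), and the dummy
destination (layer `n + 1`). -/
inductive Node (n m : ℕ) : Type
  | source : Node n m
  | inner (i : Fin n) (j : Fin (m + 1)) : Node n m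
  | dest : Node n m
  deriving DecidableEq, Fintype

/-- The directed edges of the layered graph. -/
def Arc {n m : ℕ} : Node n m → Node n m → Prop
  | .source, .inner i _ => i.val = 0
  | .inner i j, .inner i' j' => i'.val = i.val + 1 ∧ j ≤ j'
  | .inner i _, .dest => i.val + 1 = n
  | _, _ => False

/-- The set of all edges, auxiliary ones included. -/
abbrev Edge (n m : ℕ) : Type := {a : Node n m × Node n m // Arc a.1 a.2}

noncomputable instance (n m : ℕ) : Fintype (Edge n m) := Fintype.ofFinite _

/-- The auxiliary edges are those entering the dummy destination. -/
def Edge.IsAux {n m : ℕ} (e : Edge n m) : Prop := e.1.2 = Node.dest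

/-- The nodes on the source-destination path of the allocation `u`. -/
def Visits {n m : ℕ} (u : Strategy n m) : Node n m → Prop
  | .source => True
  | .inner i j => (j : ℕ) = ∑ k ∈ Finset.Iic i, (u.1 k : ℕ)
  | .dest => True

open Classical in
/-- The edges on the source-destination path of the allocation `u`. -/
noncomputable def pathEdges {n m : ℕ} (u : Strategy n m) : Finset (Edge n m) :=
  Finset.univ.filter fun e => Visits u e.1.1 ∧ Visits u e.1.2

open Classical in
/-- The characteristic vector of the path of `u`. Auxiliary edges stand for no battlefield and
are not marked, so that the vector has exactly `n` ones. -/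
noncomputable def charVec {n m : ℕ} (u : Strategy n m) : Edge n m → ℝ :=
  fun e => if e ∈ pathEdges u ∧ ¬ e.IsAux then 1 else 0

/-- The co-occurrence matrix `𝔼_{u ∼ p} [u uᵀ]`. -/
noncomputable def cooccurrence {n m : ℕ} (p : Strategy n m → ℝ) :
    Matrix (Edge n m) (Edge n m) ℝ :=
  ∑ u, p u • Matrix.vecMulVec (charVec u) (charVec u)

open Classical in
/-- The Moore-Penrose inverse of a real symmetric matrix: every nonzero eigenvalue is inverted,
and the kernel is kept. -/
noncomputable def pinv {ι : Type*} [Fintype ι] (A : Matrix ι ι ℝ) : Matrix ι ι ℝ :=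
  cfc (fun x : ℝ => x⁻¹) A

/-- `lam` is the smallest nonzero eigenvalue of the co-occurrence matrix of `μ`. -/
def IsLambdaStar {n m : ℕ} (μ : Strategy n m → ℝ) (lam : ℝ) : Prop :=
  IsLeast {x : ℝ | x ≠ 0 ∧
    Module.End.HasEigenvalue (Matrix.mulVecLin (cooccurrence μ)) x} lam

/-- `μ` explores: the paths in its support span all paths. -/
def Exploratory {n m : ℕ} (μ : Strategy n m → ℝ) : Prop :=
  Submodule.span ℝ (charVec '' {u | μ u ≠ 0}) =
    Submodule.span ℝ (Set.range (charVec (n := n) (m := m)))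

/-- Sampling a path by edge weights: a path has probability proportional to the product of the
weights of its edges. -/
noncomputable def weightLaw {n m : ℕ} (w : Edge n m → ℝ) (u : Strategy n m) : ℝ :=
  (∏ e ∈ pathEdges u, w e) / ∑ v : Strategy n m, ∏ e ∈ pathEdges v, w e

/-- The law of the sampled path: with probability `γ` from `μ`, otherwise by edge weights. -/
noncomputable def mixedLaw {n m : ℕ} (γ : ℝ) (μ : Strategy n m → ℝ) (w : Edge n m → ℝ)
    (u : Strategy n m) : ℝ :=
  (1 - γ) * weightLaw w u + γ * μ u

/-- The estimated vector when the path `u` was sampled and the reward `x` was observed. -/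
noncomputable def estimate {n m : ℕ} (γ : ℝ) (μ : Strategy n m → ℝ) (w : Edge n m → ℝ)
    (u : Strategy n m) (x : ℝ) : Edge n m → ℝ :=
  x • (pinv (cooccurrence (mixedLaw γ μ w))).mulVec (charVec u)

open Classical in
/-- The edge weights at the beginning of round `t` (rounds are `0, 1, …`) when the sampled paths
are `U 0, U 1, …` and the observed rewards are `x 0, x 1, …`. -/
noncomputable def edgeWeights {n m : ℕ} (γ η : ℝ) (μ : Strategy n m → ℝ)
    (U : ℕ → Strategy n m) (x : ℕ → ℝ) : ℕ → Edge n m → ℝ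
  | 0 => fun _ => 1
  | t + 1 => fun e =>
      if e.IsAux then edgeWeights γ η μ U x t e
      else edgeWeights γ η μ U x t e *
        Real.exp (η * estimate γ μ (edgeWeights γ η μ U x t) (U t) (x t) e)

/-- What is decided before the path of round `t` is sampled: the reward functions of the rounds
`0, …, t` and the paths of the rounds `0, …, t - 1`. -/
abbrev history {n m : ℕ} {Ω : Type*} (r : ℕ → Ω → Strategy n m → ℝ) (U : ℕ → Ω → Strategy n m)
    (t : ℕ) : MeasurableSpace Ω :=
  (⨆ s ∈ Set.Iic t, MeasurableSpace.comap (r s) inferInstance) ⊔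
    (⨆ s ∈ Set.Iio t, MeasurableSpace.comap (U s) inferInstance)

/-- `U 0, …, U (T - 1)` are the paths sampled by the Edge algorithm when the adversary selects the
reward functions `r 0, …, r (T - 1)`, possibly at random and depending on the past. The learner
only observes the numbers `r t (U t)`; given the past and the reward function of round `t`,
the path `U t` is drawn from the mixed law for the current edge weights. -/
structure IsEdgeRun {n m : ℕ} {Ω : Type*} [MeasurableSpace Ω] (P : Measure Ω) (T : ℕ)
    (γ η : ℝ) (μ : Strategy n m → ℝ) (r : ℕ → Ω → Strategy n m → ℝ)
    (U : ℕ → Ω → Strategy n m) : Prop where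
  measurable_reward : ∀ t, Measurable (r t)
  measurable_path : ∀ t, Measurable (U t)
  path_law : ∀ t < T, ∀ u : Strategy n m,
    P[Set.indicator {ω | U t ω = u} (fun _ => (1 : ℝ)) | history r U t] =ᵐ[P]
      fun ω => mixedLaw γ μ
        (edgeWeights γ η μ (fun s => U s ω) (fun s => r s ω (U s ω)) t) u

/-- The realized regret over `T` rounds against the best fixed strategy. -/
noncomputable def regret {n m : ℕ} (T : ℕ) (r : ℕ → Strategy n m → ℝ)
    (U : ℕ → Strategy n m) : ℝ :=
  (⨆ u : Strategy n m, ∑ t ∈ Finset.range T, r t u) - ∑ t ∈ Finset.range T, r t (U t)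

/-- The number `E` of edges. -/
noncomputable def numEdges (n m : ℕ) : ℝ := Fintype.card (Edge n m)

/-- The number `S` of strategies. -/
noncomputable def numStrategies (n m : ℕ) : ℝ := Fintype.card (Strategy n m)

/-- The learning rate `η`. -/
noncomputable def etaParam (n m T : ℕ) (lam : ℝ) : ℝ :=
  √(Real.log (numStrategies n m) /
    ((n / (numEdges n m * lam) + 1) * numEdges n m * (T : ℝ) ^ (2 / 3 : ℝ)))

/-- The mixing coefficient `γ`. -/
noncomputable def gammaParam (n m T : ℕ) (lam : ℝ) : ℝ :=
  n / lam * √(Real.log (numStrategies n m) /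
    ((n / (numEdges n m * lam) + 1) * numEdges n m * (T : ℝ) ^ (2 / 3 : ℝ)))

/-- The order of the regret bound. -/
noncomputable def regretRate (n m T : ℕ) (lam δ : ℝ) : ℝ :=
  (T : ℝ) ^ (2 / 3 : ℝ) *
    √((n / (numEdges n m * lam) + 1) * numEdges n m * Real.log (numStrategies n m / δ))

end ColonelBlotto

open ColonelBlotto

/-! The weight of a path is the product of its edge weights, so the updates amount to exponential
weights over all `S` paths driven by the estimated rewards. Three facts make the estimates usable,
all for `p = mixedLaw γ μ w` and `C = cooccurrence p`. Since `p ≥ γ μ` and `μ` explores, `C * pinv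
C` fixes every path vector, so the estimate of every path is unbiased. The spectral gap `lam` of
`cooccurrence μ` and Cauchy-Schwarz bound every `uᵀ C⁺ v` by `n / (γ lam)`, which the choice of
parameters makes equal to `1 / η`; hence `η` times an estimate lies in `[-1, 1]` and `exp y ≤ 1 + y
+ y²` applies. Every path vector has exactly `n` ones, so the `p`-average of the estimates is
exactly the observed reward, and the learner's own reward needs no concentration argument.

The potential argument `hedge_bound` compares the estimated reward of a competitor with the observed
rewards, up to `ln S / η`, an exploration term and `η ∑ u_tᵀ C⁺ u_t`. Two exponential
supermartingales finish the proof through `measureReal_sum_ge_le`. One bounds true minus estimated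
reward of each competitor, with its own parameter `a ≤ η` and a union bound over the `S` paths. The
other bounds the quadratic sum, whose conditional mean per round is `trace (C C⁺) ≤ E`. A lower
bound on the estimates in the exploration term comes from the same deviation event, because rewards
are nonnegative.

Collecting terms gives the rate when `δ` is not too small; otherwise the claimed bound exceeds `T`
and is trivial. -/

namespace ColonelBlotto

open Matrix

/-! ### Moore-Penrose inverse through the functional calculus -/

section Pinv

variable {ι : Type*} [Fintype ι] {A : Matrix ι ι ℝ}

open Classical in
-- The spectrum is finite, so every function is continuous on it and the functional calculus applies
-- even to the discontinuous `x⁻¹`.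
theorem cfc_mul_of_matrix (A : Matrix ι ι ℝ) (f g : ℝ → ℝ) :
    cfc f A * cfc g A = cfc (fun x => f x * g x) A :=
  (cfc_mul f g A (Matrix.finite_real_spectrum.continuousOn f)
    (Matrix.finite_real_spectrum.continuousOn g)).symm

open Classical in
theorem isSymm_cfc (A : Matrix ι ι ℝ) (f : ℝ → ℝ) : (cfc f A)ᵀ = cfc f A := by
  have h : IsSelfAdjoint (cfc f A) := cfc_predicate f A
  simpa [IsSelfAdjoint, star_eq_conjTranspose, conjTranspose_eq_transpose_of_trivial] using h

theorem isSymm_pinv (A : Matrix ι ι ℝ) : (pinv A)ᵀ = pinv A := isSymm_cfc A _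

open Classical in
theorem mul_pinv_eq_cfc (hA : A.IsHermitian) : A * pinv A = cfc (fun x : ℝ => x * x⁻¹) A := by
  rw [pinv]
  nth_rw 1 [← cfc_id' ℝ A hA.isSelfAdjoint]
  exact cfc_mul_of_matrix A _ _

open Classical in
theorem pinv_mul_eq_cfc (hA : A.IsHermitian) : pinv A * A = cfc (fun x : ℝ => x * x⁻¹) A := by
  rw [pinv]
  nth_rw 2 [← cfc_id' ℝ A hA.isSelfAdjoint]
  rw [cfc_mul_of_matrix A]
  simp_rw [mul_comm]

theorem mul_pinv_comm (hA : A.IsHermitian) : A * pinv A = pinv A * A := by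
  rw [mul_pinv_eq_cfc hA, pinv_mul_eq_cfc hA]

theorem mul_pinv_mul (hA : A.IsHermitian) : A * pinv A * A = A := by
  classical
  rw [mul_pinv_eq_cfc hA]
  nth_rw 2 [← cfc_id' ℝ A hA.isSelfAdjoint]
  rw [cfc_mul_of_matrix A]
  conv_rhs => rw [← cfc_id' ℝ A hA.isSelfAdjoint]
  congr 1
  ext x
  exact mul_inv_mul_cancel x

theorem pinv_mul_pinv (hA : A.IsHermitian) : pinv A * A * pinv A = pinv A := by
  classical
  rw [pinv_mul_eq_cfc hA, pinv, cfc_mul_of_matrix A]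
  congr 1
  ext x
  by_cases h : x = 0 <;> simp [h]

theorem isSymm_mul_pinv (hA : A.IsHermitian) : (A * pinv A)ᵀ = A * pinv A := by
  rw [mul_pinv_eq_cfc hA, isSymm_cfc]

theorem mul_pinv_mul_self (hA : A.IsHermitian) :
    A * pinv A * (A * pinv A) = A * pinv A := by
  rw [← mul_assoc, mul_pinv_mul hA]

/-- A symmetric idempotent `Q` satisfies `Q i i = ∑ j, (Q i j)² ≥ (Q i i)²`, so its diagonal entries
are at most `1`. -/
theorem trace_mul_pinv_le (hA : A.IsHermitian) : (A * pinv A).trace ≤ Fintype.card ι := by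
  have h1 : ∀ i, (A * pinv A) i i ≤ 1 := by
    intro i
    have h := congrFun (congrFun (mul_pinv_mul_self hA) i) i
    have hs : ∀ j, (A * pinv A) j i = (A * pinv A) i j := fun j =>
      congrFun (congrFun (isSymm_mul_pinv hA) i) j
    rw [Matrix.mul_apply] at h
    simp_rw [hs] at h
    have h2 : (A * pinv A) i i * (A * pinv A) i i ≤ (A * pinv A) i i := by
      nth_rw 3 [← h]
      exact Finset.single_le_sum (f := fun j => (A * pinv A) i j * (A * pinv A) i j)
        (fun j _ => mul_self_nonneg _) (Finset.mem_univ i)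
    nlinarith
  calc (A * pinv A).trace ≤ ∑ _i : ι, (1 : ℝ) := Finset.sum_le_sum fun i _ => h1 i
    _ = Fintype.card ι := by simp

open Classical in
theorem dotProduct_cfc_nonneg (A : Matrix ι ι ℝ) {f : ℝ → ℝ}
    (hf : ∀ x ∈ spectrum ℝ A, 0 ≤ f x) (x : ι → ℝ) : 0 ≤ x ⬝ᵥ cfc f A *ᵥ x := by
  have h : cfc f A = (cfc (fun x => √(f x)) A)ᵀ * cfc (fun x => √(f x)) A := by
    rw [isSymm_cfc, cfc_mul_of_matrix]
    exact cfc_congr fun y hy => (Real.mul_self_sqrt (hf y hy)).symm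
  rw [h, ← mulVec_mulVec, dotProduct_mulVec, vecMul_transpose]
  exact Finset.sum_nonneg fun i _ => mul_self_nonneg _

/-- The function `y - c * (y * y⁻¹)` is nonnegative on the spectrum: it vanishes at `0` because `0⁻¹
= 0`, and equals `y - c` elsewhere. -/
theorem spectral_gap (hA : A.IsHermitian) {c : ℝ}
    (hc : ∀ y, y ≠ 0 → Module.End.HasEigenvalue (Matrix.mulVecLin A) y → c ≤ y) (x : ι → ℝ) :
    c * (x ⬝ᵥ (A * pinv A) *ᵥ x) ≤ x ⬝ᵥ A *ᵥ x := by
  classical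
  have h : cfc (fun y : ℝ => y - c * (y * y⁻¹)) A = A - c • (A * pinv A) := by
    rw [cfc_sub (fun y : ℝ => y) (fun y : ℝ => c * (y * y⁻¹)) A
      (Matrix.finite_real_spectrum.continuousOn _) (Matrix.finite_real_spectrum.continuousOn _),
      cfc_const_mul c (fun y : ℝ => y * y⁻¹) A (Matrix.finite_real_spectrum.continuousOn _),
      cfc_id' ℝ A hA.isSelfAdjoint, mul_pinv_eq_cfc hA]
  have h2 := dotProduct_cfc_nonneg A (f := fun y : ℝ => y - c * (y * y⁻¹)) ?_ x
  · rw [h, sub_mulVec, dotProduct_sub, smul_mulVec, dotProduct_smul, smul_eq_mul] at h2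
    linarith
  · intro y hy
    by_cases h0 : y = 0
    · simp [h0]
    · rw [← Matrix.spectrum_toLin', ← Module.End.hasEigenvalue_iff_mem_spectrum] at hy
      have := hc y h0 hy
      simp only [mul_inv_cancel₀ h0]
      linarith

end Pinv

/-! ### Paths, their characteristic vectors and the linearity of the payoff -/

section Paths

variable {n m : ℕ}

/-- The number of troops spent on the battlefields up to `i`. -/
def spent (u : Strategy n m) (i : Fin n) : Fin (m + 1) :=
  ⟨∑ k ∈ Finset.Iic i, (u.1 k : ℕ), Nat.lt_succ_of_le
    ((Finset.sum_le_sum_of_subset (Finset.subset_univ _)).trans u.2)⟩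

/-- The node of the path of `u` in the layer before battlefield `i` is decided. -/
def prevNode (u : Strategy n m) (i : Fin n) : Node n m :=
  if i.val = 0 then .source else .inner ⟨i.val - 1, by omega⟩ (spent u ⟨i.val - 1, by omega⟩)

theorem spent_mono (u : Strategy n m) {i j : Fin n} (h : i ≤ j) : spent u i ≤ spent u j :=
  Fin.mk_le_mk.2 (Finset.sum_le_sum_of_subset (Finset.Iic_subset_Iic.2 h))

theorem arc_prevNode (u : Strategy n m) (i : Fin n) :
    Arc (prevNode u i) (.inner i (spent u i)) := by
  unfold prevNode
  split_ifs with h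
  · exact h
  · exact ⟨by simp; omega, spent_mono u (Fin.mk_le_mk.2 (by omega))⟩

/-- The edge of the path of `u` that stands for battlefield `i`. -/
def stepEdge (u : Strategy n m) (i : Fin n) : Edge n m :=
  ⟨(prevNode u i, .inner i (spent u i)), arc_prevNode u i⟩

theorem stepEdge_injective (u : Strategy n m) : Function.Injective (stepEdge u) := by
  intro i j h
  have h1 : Node.inner i (spent u i) = Node.inner j (spent u j) :=
    congrArg (fun e : Edge n m => e.1.2) h
  exact (Node.inner.inj h1).1

theorem mem_pathEdges_iff (u : Strategy n m) (e : Edge n m) :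
    (e ∈ pathEdges u ∧ ¬ e.IsAux) ↔ ∃ i, stepEdge u i = e := by
  constructor
  · rintro ⟨he, haux⟩
    obtain ⟨⟨a, b⟩, harc⟩ := e
    simp only [pathEdges, Finset.mem_filter, Finset.mem_univ, true_and] at he
    obtain ⟨ha, hb⟩ := he
    cases b with
    | source => cases a <;> exact harc.elim
    | dest => exact (haux rfl).elim
    | inner i j =>
      have hj : spent u i = j := Fin.ext hb.symm
      refine ⟨i, Subtype.ext (Prod.ext ?_ (by simp [stepEdge, hj]))⟩
      cases a with
      | source => exact if_pos harc
      | dest => exact harc.elim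
      | inner i' j' =>
        have hi : i.val = i'.val + 1 := harc.1
        have hj' : spent u i' = j' := Fin.ext ha.symm
        have hi' : (⟨i.val - 1, by omega⟩ : Fin n) = i' := Fin.ext (by simp; omega)
        simp only [stepEdge, prevNode]
        rw [if_neg (by omega), hi', hj']
  · rintro ⟨i, rfl⟩
    refine ⟨?_, fun h => by cases h⟩
    simp only [pathEdges, Finset.mem_filter, Finset.mem_univ, true_and]
    refine ⟨?_, rfl⟩
    simp only [stepEdge, prevNode]
    split_ifs
    · trivial
    · rfl

theorem dotProduct_charVec (f : Edge n m → ℝ) (u : Strategy n m) :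
    f ⬝ᵥ charVec u = ∑ i, f (stepEdge u i) := by
  classical
  have h : (Finset.univ.filter fun e : Edge n m => e ∈ pathEdges u ∧ ¬ e.IsAux) =
      Finset.univ.image (stepEdge u) := by
    ext e
    simp [mem_pathEdges_iff]
  simp only [dotProduct, charVec, mul_ite, mul_one, mul_zero]
  rw [← Finset.sum_filter]
  convert Finset.sum_image (fun i _ j _ hij => stepEdge_injective u hij)

theorem one_dotProduct_charVec (u : Strategy n m) : (1 : Edge n m → ℝ) ⬝ᵥ charVec u = n := by
  simp [dotProduct_charVec]

theorem charVec_dotProduct_self (u : Strategy n m) : charVec u ⬝ᵥ charVec u = n := by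
  rw [← one_dotProduct_charVec u]
  simp only [dotProduct, charVec]
  refine Finset.sum_congr rfl fun e _ => ?_
  split_ifs <;> simp

/-- The number of troops that an edge into an inner node spends. -/
def edgeSpend : Node n m × Node n m → ℕ
  | (.source, .inner _ j) => j
  | (.inner _ j, .inner _ j') => j' - j
  | _ => 0

theorem edgeSpend_stepEdge (u : Strategy n m) (i : Fin n) :
    edgeSpend (stepEdge u i).1 = u.1 i := by
  simp only [stepEdge, prevNode]
  split_ifs with h
  · have : Finset.Iic i = {i} := by
      ext k
      rw [Finset.mem_Iic, Finset.mem_singleton, Fin.le_def, Fin.ext_iff]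
      omega
    simp [edgeSpend, spent, this]
  · have : Finset.Iic i = insert i (Finset.Iic (⟨i.val - 1, by omega⟩ : Fin n)) := by
      ext k
      rw [Finset.mem_insert, Finset.mem_Iic, Finset.mem_Iic, Fin.le_def, Fin.le_def, Fin.ext_iff]
      simp only
      omega
    simp only [edgeSpend, spent, this]
    rw [Finset.sum_insert (by simp [Fin.le_def]; omega)]
    simp

/-- The vector on the edges that represents the Colonel Blotto payoff against `v`. -/
noncomputable def payoffVec (b : Fin n → ℝ) (v : Fin n → ℕ) (e : Edge n m) : ℝ :=
  match e.1.2 with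
  | .inner i _ => b i * (if v i < edgeSpend e.1 then 1 else
      if edgeSpend e.1 = v i then 1 / 2 else 0)
  | _ => 0

/-- The endpoints of a path edge determine both the battlefield and the troops spent there, which
makes the game a linear bandit problem on the edges. -/
theorem payoff_eq_dotProduct (b : Fin n → ℝ) (u : Strategy n m) (v : Fin n → ℕ) :
    payoff b u v = payoffVec b v ⬝ᵥ charVec u := by
  rw [dotProduct_charVec]
  refine Finset.sum_congr rfl fun i _ => ?_
  rw [← edgeSpend_stepEdge u i]
  rfl

theorem payoff_mem_Icc {b : Fin n → ℝ} (hb : ∀ i, 0 < b i) (hsum : ∑ i, b i = 1)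
    (u : Strategy n m) (v : Fin n → ℕ) : payoff b u v ∈ Set.Icc (0 : ℝ) 1 := by
  constructor
  · exact Finset.sum_nonneg fun i _ => mul_nonneg (hb i).le (by split_ifs <;> norm_num)
  · rw [← hsum]
    exact Finset.sum_le_sum fun i _ =>
      mul_le_of_le_one_right (hb i).le (by split_ifs <;> norm_num)

instance : Nonempty (Strategy n m) := ⟨⟨0, by simp⟩⟩

theorem subsingleton_strategy : Subsingleton (Strategy n 0) :=
  ⟨fun _ _ => Subtype.ext (funext fun _ => Subsingleton.elim (α := Fin 1) _ _)⟩

theorem two_le_numStrategies (hn : 1 ≤ n) (hm : 1 ≤ m) : 2 ≤ numStrategies n m := by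
  have h : 1 < Fintype.card (Strategy n m) := by
    rw [Fintype.one_lt_card_iff]
    refine ⟨⟨0, by simp⟩, ⟨Pi.single ⟨0, hn⟩ ⟨1, by omega⟩, ?_⟩, fun h => ?_⟩
    · rw [Finset.sum_eq_single ⟨0, hn⟩]
      · simpa using hm
      · intro j _ hj; simp [Pi.single_eq_of_ne hj]
      · simp
    · have := congrFun (congrArg Subtype.val h) ⟨0, hn⟩
      simp [Fin.ext_iff] at this
  rw [numStrategies]
  exact_mod_cast h

theorem two_le_numEdges (hn : 1 ≤ n) (hm : 1 ≤ m) : 2 ≤ numEdges n m := by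
  have h : Fintype.card (Fin (m + 1)) ≤ Fintype.card (Edge n m) := by
    refine Fintype.card_le_of_injective
      (fun j => ⟨(.source, .inner ⟨0, hn⟩ j), rfl⟩) fun i j hij => ?_
    have h1 : Node.inner (⟨0, hn⟩ : Fin n) i = Node.inner ⟨0, hn⟩ j :=
      congrArg (fun e : Edge n m => e.1.2) hij
    exact (Node.inner.inj h1).2
  have h2 : 2 ≤ Fintype.card (Edge n m) := by
    rw [Fintype.card_fin] at h; omega
  rw [numEdges]
  exact_mod_cast h2

end Paths

/-- Adding the projection onto the kernel makes `A` invertible without changing it on its range.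
Once the range is known to be fixed, this makes `pinv A` a measurable function of the entries of
`A`. -/
theorem pinv_eq_inv_sub {ι : Type*} [Fintype ι] [DecidableEq ι] {A : Matrix ι ι ℝ}
    (hA : A.IsHermitian) :
    pinv A = (A + (1 - A * pinv A))⁻¹ - (1 - A * pinv A) := by
  rw [eq_sub_iff_add_eq, eq_comm]
  refine Matrix.inv_eq_right_inv ?_
  have h1 : A * pinv A * pinv A = pinv A := by rw [mul_pinv_comm hA, pinv_mul_pinv hA]
  have h2 : A * (A * pinv A) = A := by rw [mul_pinv_comm hA, ← mul_assoc, mul_pinv_mul hA]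
  have h3 := mul_pinv_mul_self hA
  rw [add_mul, mul_add, mul_add, sub_mul, mul_sub, mul_sub, sub_mul, sub_mul, h1, h2, h3]
  simp

/-! ### Co-occurrence matrices of exploring laws: unbiasedness and moment bounds -/

section Cooccurrence

variable {n m : ℕ} {p μ : Strategy n m → ℝ} {γ lam : ℝ}

theorem isHermitian_cooccurrence (p : Strategy n m → ℝ) : (cooccurrence p).IsHermitian := by
  rw [IsHermitian, conjTranspose_eq_transpose_of_trivial, cooccurrence, transpose_sum]
  refine Finset.sum_congr rfl fun u _ => ?_
  rw [transpose_smul, transpose_vecMulVec]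

theorem dotProduct_cooccurrence_mulVec (p : Strategy n m → ℝ) (x y : Edge n m → ℝ) :
    x ⬝ᵥ cooccurrence p *ᵥ y = ∑ u, p u * ((x ⬝ᵥ charVec u) * (charVec u ⬝ᵥ y)) := by
  rw [cooccurrence, sum_mulVec, dotProduct_sum]
  refine Finset.sum_congr rfl fun u _ => ?_
  rw [smul_mulVec, dotProduct_smul, smul_eq_mul, vecMulVec_mulVec]
  simp [dotProduct_smul, mul_comm]

theorem dotProduct_pinv_comm {ι : Type*} [Fintype ι] (A : Matrix ι ι ℝ) (x y : ι → ℝ) :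
    x ⬝ᵥ pinv A *ᵥ y = y ⬝ᵥ pinv A *ᵥ x := by
  rw [dotProduct_mulVec, ← mulVec_transpose, isSymm_pinv, dotProduct_comm]

/-- The residual `x` of `charVec u` under the projection lies in the kernel, so `0 = xᵀ C x = ∑ p v
(v · x)²` makes `x` orthogonal to the support of `μ`, hence to all paths. It is also orthogonal to
the projected part, so `x · x = 0`. -/
theorem cooccurrence_pinv_mulVec_charVec (hp : ∀ u, 0 ≤ p u) (hpμ : ∀ u, μ u ≠ 0 → p u ≠ 0)
    (hμ : Exploratory μ) (u : Strategy n m) :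
    (cooccurrence p * pinv (cooccurrence p)) *ᵥ charVec u = charVec u := by
  have hA := isHermitian_cooccurrence p
  set A := cooccurrence p with hAdef
  set x := charVec u - (A * pinv A) *ᵥ charVec u with hx
  have hAx : A *ᵥ x = 0 := by
    rw [hx, mulVec_sub, mulVec_mulVec, mul_pinv_comm hA, ← mul_assoc, mul_pinv_mul hA, sub_self]
  have hv : ∀ v, μ v ≠ 0 → charVec v ⬝ᵥ x = 0 := by
    intro v hμv
    have h := dotProduct_cooccurrence_mulVec p x x
    rw [← hAdef, hAx, dotProduct_zero] at h
    have h' := (Finset.sum_eq_zero_iff_of_nonneg (fun w _ => by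
      rw [dotProduct_comm x]; exact mul_nonneg (hp w) (mul_self_nonneg _))).1 h.symm v
      (Finset.mem_univ v)
    rw [dotProduct_comm x] at h'
    simpa [hpμ v hμv] using h'
  have hspan : ∀ y ∈ Submodule.span ℝ (charVec '' {u | μ u ≠ 0}), y ⬝ᵥ x = 0 := by
    intro y hy
    induction hy using Submodule.span_induction with
    | mem y h => obtain ⟨v, hv', rfl⟩ := h; exact hv v hv'
    | zero => simp
    | add a b _ _ ha hb => rw [add_dotProduct, ha, hb, add_zero]
    | smul c a _ ha => rw [smul_dotProduct, ha, smul_zero]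
  have hu : charVec u ⬝ᵥ x = 0 := by
    refine hspan _ ?_
    rw [hμ]
    exact Submodule.subset_span ⟨u, rfl⟩
  have hPx : (A * pinv A) *ᵥ x = 0 := by
    rw [mul_pinv_comm hA, ← mulVec_mulVec, hAx, mulVec_zero]
  have hu' : (A * pinv A) *ᵥ charVec u ⬝ᵥ x = 0 := by
    rw [dotProduct_comm, dotProduct_mulVec, ← mulVec_transpose, isSymm_mul_pinv hA, hPx,
      zero_dotProduct]
  have hxx : x ⬝ᵥ x = 0 := by
    conv_lhs => rw [hx]
    rw [sub_dotProduct, hu, ← hx, hu', sub_zero]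
  have := dotProduct_self_eq_zero.1 hxx
  exact (sub_eq_zero.1 this).symm

/-- Each projection fixes all paths and therefore the other matrix, so the product in either order
is the right factor; transposing one product identifies the two. -/
theorem cooccurrence_pinv_unique {p' : Strategy n m → ℝ}
    (h : ∀ u, (cooccurrence p * pinv (cooccurrence p)) *ᵥ charVec u = charVec u)
    (h' : ∀ u, (cooccurrence p' * pinv (cooccurrence p')) *ᵥ charVec u = charVec u) :
    cooccurrence p * pinv (cooccurrence p) = cooccurrence p' * pinv (cooccurrence p') := by
  have key : ∀ q q' : Strategy n m → ℝ,
      (∀ u, (cooccurrence q * pinv (cooccurrence q)) *ᵥ charVec u = charVec u) →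
      cooccurrence q * pinv (cooccurrence q) * (cooccurrence q' * pinv (cooccurrence q')) =
        cooccurrence q' * pinv (cooccurrence q') := by
    intro q q' hq
    have : cooccurrence q * pinv (cooccurrence q) * cooccurrence q' = cooccurrence q' := by
      conv_lhs => rw [cooccurrence.eq_1 q']
      rw [Matrix.mul_sum, cooccurrence.eq_1 q']
      refine Finset.sum_congr rfl fun u _ => ?_
      rw [Matrix.mul_smul, mul_vecMulVec, hq u]
    rw [← mul_assoc, this]
  have h1 := congrArg transpose (key p p' h)
  rw [transpose_mul, isSymm_mul_pinv (isHermitian_cooccurrence p),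
    isSymm_mul_pinv (isHermitian_cooccurrence p'), key p' p h'] at h1
  exact h1

theorem lambdaStar_pos (hμ : ∀ u, 0 ≤ μ u) (hlam : IsLambdaStar μ lam) : 0 < lam := by
  obtain ⟨⟨h0, hev⟩, -⟩ := hlam
  obtain ⟨x, hx⟩ := hev.exists_hasEigenvector
  have h1 : cooccurrence μ *ᵥ x = lam • x := hx.apply_eq_smul
  have h2 : x ⬝ᵥ cooccurrence μ *ᵥ x = lam * (x ⬝ᵥ x) := by
    rw [h1, dotProduct_smul, smul_eq_mul]
  have h3 : 0 ≤ x ⬝ᵥ cooccurrence μ *ᵥ x := by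
    rw [dotProduct_cooccurrence_mulVec]
    exact Finset.sum_nonneg fun u _ => by
      rw [dotProduct_comm x]; exact mul_nonneg (hμ u) (mul_self_nonneg _)
  have h4 : 0 < x ⬝ᵥ x :=
    lt_of_le_of_ne (Finset.sum_nonneg fun i _ => mul_self_nonneg _)
      fun h => hx.2 (dotProduct_self_eq_zero.1 h.symm)
  rw [h2] at h3
  exact lt_of_le_of_ne (nonneg_of_mul_nonneg_left h3 h4) (Ne.symm h0)

/-- The sampling laws for which the estimates are controlled: they explore at rate `γ`. -/
structure Dominates (γ : ℝ) (μ p : Strategy n m → ℝ) : Prop where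
  pos : 0 < γ
  nonneg : ∀ u, 0 ≤ μ u
  exploratory : Exploratory μ
  le : ∀ u, γ * μ u ≤ p u

theorem Dominates.law_nonneg (h : Dominates γ μ p) (u : Strategy n m) : 0 ≤ p u :=
  (mul_nonneg h.pos.le (h.nonneg u)).trans (h.le u)

theorem Dominates.mulVec_charVec (h : Dominates γ μ p) (u : Strategy n m) :
    (cooccurrence p * pinv (cooccurrence p)) *ᵥ charVec u = charVec u := by
  refine cooccurrence_pinv_mulVec_charVec h.law_nonneg (fun u hu => ?_) h.exploratory u
  exact ((mul_pos h.pos (lt_of_le_of_ne (h.nonneg u) hu.symm)).trans_le (h.le u)).ne'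

theorem Dominates.mulVec_charVec_exploration (h : Dominates γ μ p) (u : Strategy n m) :
    (cooccurrence μ * pinv (cooccurrence μ)) *ᵥ charVec u = charVec u :=
  cooccurrence_pinv_mulVec_charVec h.nonneg (fun _ hu => hu) h.exploratory u

theorem Dominates.projection_eq (h : Dominates γ μ p) :
    cooccurrence p * pinv (cooccurrence p) = cooccurrence μ * pinv (cooccurrence μ) :=
  cooccurrence_pinv_unique h.mulVec_charVec h.mulVec_charVec_exploration

theorem Dominates.cooccurrence_mulVec_pinv (h : Dominates γ μ p) (u : Strategy n m) :
    cooccurrence p *ᵥ (pinv (cooccurrence p) *ᵥ charVec u) = charVec u := by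
  rw [mulVec_mulVec, h.mulVec_charVec]

/-- Unbiasedness of the estimator, in the form `ℓᵀ C C⁺ u = ℓᵀ u`. -/
theorem Dominates.sum_bilinear (h : Dominates γ μ p) (ℓ : Edge n m → ℝ) (u : Strategy n m) :
    ∑ v, p v * ((ℓ ⬝ᵥ charVec v) * (charVec v ⬝ᵥ pinv (cooccurrence p) *ᵥ charVec u)) =
      ℓ ⬝ᵥ charVec u := by
  rw [← dotProduct_cooccurrence_mulVec, h.cooccurrence_mulVec_pinv]

theorem Dominates.sum_eq_one (h : Dominates γ μ p) (hn : 1 ≤ n) (u : Strategy n m) :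
    ∑ v, p v * (charVec v ⬝ᵥ pinv (cooccurrence p) *ᵥ charVec u) = 1 := by
  -- The all-ones vector has the same product `n` with every path, so it represents a constant
  -- reward.
  have h1 := h.sum_bilinear 1 u
  simp only [one_dotProduct_charVec] at h1
  have h2 : (n : ℝ) * ∑ v, p v * (charVec v ⬝ᵥ pinv (cooccurrence p) *ᵥ charVec u) = n := by
    rw [Finset.mul_sum]
    conv_rhs => rw [← h1]
    exact Finset.sum_congr rfl fun v _ => by ring
  have hn' : (n : ℝ) ≠ 0 := by positivity
  exact mul_left_cancel₀ hn' (by rw [h2, mul_one])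

theorem Dominates.sum_sq (h : Dominates γ μ p) (u : Strategy n m) :
    ∑ v, p v * (charVec v ⬝ᵥ pinv (cooccurrence p) *ᵥ charVec u) ^ 2 =
      charVec u ⬝ᵥ pinv (cooccurrence p) *ᵥ charVec u := by
  rw [dotProduct_comm (charVec u), ← h.sum_bilinear (pinv (cooccurrence p) *ᵥ charVec u) u]
  refine Finset.sum_congr rfl fun v _ => ?_
  rw [dotProduct_comm _ (charVec v), sq]

theorem Dominates.quadratic_nonneg (h : Dominates γ μ p) (u : Strategy n m) :
    0 ≤ charVec u ⬝ᵥ pinv (cooccurrence p) *ᵥ charVec u := by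
  rw [← h.sum_sq u]
  exact Finset.sum_nonneg fun v _ => mul_nonneg (h.law_nonneg v) (sq_nonneg _)

/-- Put `x = C⁺ u`. Then `u · x = xᵀ C x ≥ γ xᵀ C(μ) x ≥ γ lam |x|²`, the gap being available
because `x` lies in the common range, while Cauchy-Schwarz gives `(u · x)² ≤ n |x|²`. -/
theorem Dominates.quadratic_le (h : Dominates γ μ p) (hlam : IsLambdaStar μ lam)
    (u : Strategy n m) :
    charVec u ⬝ᵥ pinv (cooccurrence p) *ᵥ charVec u ≤ n / (γ * lam) := by
  have hlam0 := lambdaStar_pos h.nonneg hlam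
  have hA := isHermitian_cooccurrence p
  set x := pinv (cooccurrence p) *ᵥ charVec u with hx
  have hPx : (cooccurrence μ * pinv (cooccurrence μ)) *ᵥ x = x := by
    rw [← h.projection_eq, hx, mulVec_mulVec, mul_pinv_comm hA, pinv_mul_pinv hA]
  have hgap := spectral_gap (isHermitian_cooccurrence μ) (c := lam)
    (fun y hy0 hy => hlam.2 ⟨hy0, hy⟩) x
  rw [hPx, dotProduct_cooccurrence_mulVec] at hgap
  have hle : γ * ∑ v, μ v * ((x ⬝ᵥ charVec v) * (charVec v ⬝ᵥ x)) ≤ charVec u ⬝ᵥ x := by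
    rw [← h.sum_sq u, Finset.mul_sum]
    refine Finset.sum_le_sum fun v _ => ?_
    rw [dotProduct_comm x, ← sq, ← mul_assoc]
    exact mul_le_mul_of_nonneg_right (h.le v) (sq_nonneg _)
  have h1 : γ * lam * (x ⬝ᵥ x) ≤ charVec u ⬝ᵥ x := by
    have := mul_le_mul_of_nonneg_left hgap h.pos.le
    linarith
  have hcs : (charVec u ⬝ᵥ x) ^ 2 ≤ n * (x ⬝ᵥ x) := by
    rw [← charVec_dotProduct_self u]
    have := Finset.sum_mul_sq_le_sq_mul_sq Finset.univ (charVec u) x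
    simpa [dotProduct, sq] using this
  have h0 : 0 ≤ charVec u ⬝ᵥ x := h.quadratic_nonneg u
  have hc : 0 < γ * lam := mul_pos h.pos hlam0
  rw [le_div_iff₀ hc]
  rcases h0.eq_or_lt with h00 | h00
  · rw [← h00]; simp
  · refine le_of_mul_le_mul_left ?_ h00
    have hn0 : (0 : ℝ) ≤ n := n.cast_nonneg
    have := mul_le_mul_of_nonneg_left h1 hn0
    have := mul_le_mul_of_nonneg_left hcs hc.le
    nlinarith

/-- Writing `uᵀ C⁺ v` as the `p`-average of `(w · C⁺ u)(w · C⁺ v)` reduces it to the diagonal case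
by `2xy ≤ x² + y²`. -/
theorem Dominates.abs_bilinear_le (h : Dominates γ μ p) (hlam : IsLambdaStar μ lam)
    (u v : Strategy n m) :
    |charVec u ⬝ᵥ pinv (cooccurrence p) *ᵥ charVec v| ≤ n / (γ * lam) := by
  have h1 := h.sum_bilinear (pinv (cooccurrence p) *ᵥ charVec u) v
  rw [dotProduct_comm _ (charVec v), dotProduct_pinv_comm] at h1
  rw [← h1]
  calc |∑ w, p w * ((pinv (cooccurrence p) *ᵥ charVec u ⬝ᵥ charVec w) *
          (charVec w ⬝ᵥ pinv (cooccurrence p) *ᵥ charVec v))|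
      ≤ ∑ w, (p w * (charVec w ⬝ᵥ pinv (cooccurrence p) *ᵥ charVec u) ^ 2 +
          p w * (charVec w ⬝ᵥ pinv (cooccurrence p) *ᵥ charVec v) ^ 2) / 2 := by
        refine (Finset.abs_sum_le_sum_abs _ _).trans (Finset.sum_le_sum fun w _ => ?_)
        rw [abs_mul, abs_of_nonneg (h.law_nonneg w), dotProduct_comm _ (charVec w),
          ← mul_add, mul_div_assoc]
        refine mul_le_mul_of_nonneg_left ?_ (h.law_nonneg w)
        rw [abs_mul, ← sq_abs (charVec w ⬝ᵥ pinv (cooccurrence p) *ᵥ charVec u),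
          ← sq_abs (charVec w ⬝ᵥ pinv (cooccurrence p) *ᵥ charVec v)]
        have := two_mul_le_add_sq |charVec w ⬝ᵥ pinv (cooccurrence p) *ᵥ charVec u|
          |charVec w ⬝ᵥ pinv (cooccurrence p) *ᵥ charVec v|
        linarith
    _ ≤ n / (γ * lam) := by
        rw [← Finset.sum_div, Finset.sum_add_distrib, h.sum_sq, h.sum_sq]
        have := h.quadratic_le hlam u
        have := h.quadratic_le hlam v
        linarith

theorem trace_mul_cooccurrence (M : Matrix (Edge n m) (Edge n m) ℝ) (p : Strategy n m → ℝ) :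
    (M * cooccurrence p).trace = ∑ u, p u * (charVec u ⬝ᵥ M *ᵥ charVec u) := by
  rw [cooccurrence, Matrix.mul_sum, trace_sum]
  refine Finset.sum_congr rfl fun u _ => ?_
  rw [Matrix.mul_smul, trace_smul, smul_eq_mul, mul_vecMulVec, trace_vecMulVec, dotProduct_comm]

theorem sum_quadratic_le (p : Strategy n m → ℝ) :
    ∑ u, p u * (charVec u ⬝ᵥ pinv (cooccurrence p) *ᵥ charVec u) ≤ numEdges n m := by
  rw [← trace_mul_cooccurrence, trace_mul_comm]
  exact trace_mul_pinv_le (isHermitian_cooccurrence p)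

end Cooccurrence

/-! ### Exponential weights: the potential argument along a fixed run -/

section Weights

variable {n m : ℕ} {μ : Strategy n m → ℝ} {γ η lam : ℝ} {w : Edge n m → ℝ}

theorem sum_prod_pos (hw : ∀ e, 0 < w e) :
    0 < ∑ v : Strategy n m, ∏ e ∈ pathEdges v, w e :=
  Finset.sum_pos (fun _ _ => Finset.prod_pos fun e _ => hw e) Finset.univ_nonempty

theorem weightLaw_nonneg (hw : ∀ e, 0 < w e) (u : Strategy n m) : 0 ≤ weightLaw w u :=
  div_nonneg (Finset.prod_nonneg fun e _ => (hw e).le) (sum_prod_pos hw).le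

theorem sum_weightLaw (hw : ∀ e, 0 < w e) : ∑ u : Strategy n m, weightLaw w u = 1 := by
  simp only [weightLaw]
  rw [← Finset.sum_div, div_self (sum_prod_pos hw).ne']

theorem sum_mixedLaw (hμ : μ ∈ stdSimplex ℝ (Strategy n m)) (hw : ∀ e, 0 < w e) :
    ∑ u, mixedLaw γ μ w u = 1 := by
  simp only [mixedLaw, Finset.sum_add_distrib, ← Finset.mul_sum, sum_weightLaw hw, hμ.2]
  ring

theorem dominates_mixedLaw (hμ : μ ∈ stdSimplex ℝ (Strategy n m)) (hexp : Exploratory μ)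
    (hγ0 : 0 < γ) (hγ1 : γ ≤ 1) (hw : ∀ e, 0 < w e) : Dominates γ μ (mixedLaw γ μ w) where
  pos := hγ0
  nonneg := hμ.1
  exploratory := hexp
  le u := le_add_of_nonneg_left (mul_nonneg (by linarith) (weightLaw_nonneg hw u))

theorem estimate_dotProduct (γ : ℝ) (μ : Strategy n m → ℝ) (w : Edge n m → ℝ)
    (u v : Strategy n m) (x : ℝ) :
    estimate γ μ w u x ⬝ᵥ charVec v =
      x * (charVec v ⬝ᵥ pinv (cooccurrence (mixedLaw γ μ w)) *ᵥ charVec u) := by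
  rw [estimate, smul_dotProduct, smul_eq_mul, dotProduct_comm]

theorem edgeWeights_pos (γ η : ℝ) (μ : Strategy n m → ℝ) (U : ℕ → Strategy n m) (x : ℕ → ℝ)
    (t : ℕ) (e : Edge n m) : 0 < edgeWeights γ η μ U x t e := by
  induction t generalizing e with
  | zero => exact one_pos
  | succ t ih =>
    rw [edgeWeights]
    beta_reduce
    split_ifs
    · exact ih e
    · exact mul_pos (ih e) (Real.exp_pos _)

/-- Updating edges separately is the exponential update of whole paths; auxiliary edges contribute
neither to the product update nor to `charVec`. -/
theorem prod_edgeWeights_succ (γ η : ℝ) (μ : Strategy n m → ℝ) (U : ℕ → Strategy n m)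
    (x : ℕ → ℝ) (t : ℕ) (v : Strategy n m) :
    ∏ e ∈ pathEdges v, edgeWeights γ η μ U x (t + 1) e =
      (∏ e ∈ pathEdges v, edgeWeights γ η μ U x t e) *
        Real.exp (η * (estimate γ μ (edgeWeights γ η μ U x t) (U t) (x t) ⬝ᵥ charVec v)) := by
  classical
  have h : η * (estimate γ μ (edgeWeights γ η μ U x t) (U t) (x t) ⬝ᵥ charVec v) =
      ∑ e ∈ pathEdges v, if e.IsAux then 0
        else η * estimate γ μ (edgeWeights γ η μ U x t) (U t) (x t) e := by
    rw [dotProduct, Finset.mul_sum,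
      ← Finset.sum_subset (Finset.subset_univ (pathEdges v))
        (fun e _ he => by simp [charVec, he])]
    refine Finset.sum_congr rfl fun e he => ?_
    by_cases ha : e.IsAux <;> simp [charVec, he, ha]
  rw [h, Real.exp_sum, ← Finset.prod_mul_distrib]
  refine Finset.prod_congr rfl fun e _ => ?_
  rw [edgeWeights]
  by_cases ha : e.IsAux <;> simp [ha]

theorem exp_le_one_add_add_sq {x : ℝ} (hx : |x| ≤ 1) : Real.exp x ≤ 1 + x + x ^ 2 := by
  have := (abs_le.1 (Real.abs_exp_sub_one_sub_id_le hx)).2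
  linarith

theorem sum_prod_edgeWeights_succ_le (U : ℕ → Strategy n m) (x : ℕ → ℝ) (t : ℕ)
    (h : ∀ v, |η * (estimate γ μ (edgeWeights γ η μ U x t) (U t) (x t) ⬝ᵥ charVec v)| ≤ 1) :
    ∑ v, ∏ e ∈ pathEdges v, edgeWeights γ η μ U x (t + 1) e ≤
      (∑ v, ∏ e ∈ pathEdges v, edgeWeights γ η μ U x t e) *
        Real.exp (∑ v, weightLaw (edgeWeights γ η μ U x t) v *
          (η * (estimate γ μ (edgeWeights γ η μ U x t) (U t) (x t) ⬝ᵥ charVec v) +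
          (η * (estimate γ μ (edgeWeights γ η μ U x t) (U t) (x t) ⬝ᵥ charVec v)) ^ 2)) := by
  have hw := edgeWeights_pos γ η μ U x t
  set w := edgeWeights γ η μ U x t
  set y := fun v => η * (estimate γ μ w (U t) (x t) ⬝ᵥ charVec v) with hy
  have hW := sum_prod_pos hw
  calc ∑ v, ∏ e ∈ pathEdges v, edgeWeights γ η μ U x (t + 1) e
      = ∑ v, (∏ e ∈ pathEdges v, w e) * Real.exp (y v) :=
        Finset.sum_congr rfl fun v _ => prod_edgeWeights_succ γ η μ U x t v
    _ = (∑ v, ∏ e ∈ pathEdges v, w e) * ∑ v, weightLaw w v * Real.exp (y v) := by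
        rw [Finset.mul_sum]
        refine Finset.sum_congr rfl fun v _ => ?_
        rw [weightLaw]
        field_simp
    _ ≤ (∑ v, ∏ e ∈ pathEdges v, w e) * ∑ v, weightLaw w v * (1 + y v + y v ^ 2) := by
        refine mul_le_mul_of_nonneg_left (Finset.sum_le_sum fun v _ => ?_) hW.le
        exact mul_le_mul_of_nonneg_left (exp_le_one_add_add_sq (h v)) (weightLaw_nonneg hw v)
    _ = (∑ v, ∏ e ∈ pathEdges v, w e) * (∑ v, weightLaw w v * (y v + y v ^ 2) + 1) := by
        congr 1
        conv_rhs => rw [← sum_weightLaw hw, ← Finset.sum_add_distrib]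
        exact Finset.sum_congr rfl fun v _ => by ring
    _ ≤ _ := mul_le_mul_of_nonneg_left (Real.add_one_le_exp _) hW.le

theorem sum_prod_edgeWeights_le (U : ℕ → Strategy n m) (x : ℕ → ℝ) (T : ℕ)
    (h : ∀ t < T, ∀ v,
      |η * (estimate γ μ (edgeWeights γ η μ U x t) (U t) (x t) ⬝ᵥ charVec v)| ≤ 1) :
    ∑ v, ∏ e ∈ pathEdges v, edgeWeights γ η μ U x T e ≤
      numStrategies n m *
        Real.exp (∑ t ∈ Finset.range T, ∑ v, weightLaw (edgeWeights γ η μ U x t) v *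
          (η * (estimate γ μ (edgeWeights γ η μ U x t) (U t) (x t) ⬝ᵥ charVec v) +
          (η * (estimate γ μ (edgeWeights γ η μ U x t) (U t) (x t) ⬝ᵥ charVec v)) ^ 2)) := by
  induction T with
  | zero => simp [edgeWeights, numStrategies]
  | succ T ih =>
    refine (sum_prod_edgeWeights_succ_le U x T (h T (Nat.lt_succ_self T))).trans ?_
    rw [Finset.sum_range_succ, Real.exp_add, ← mul_assoc]
    exact mul_le_mul_of_nonneg_right (ih fun t ht => h t (ht.trans (Nat.lt_succ_self T)))
      (Real.exp_pos _).le

theorem prod_edgeWeights (γ η : ℝ) (μ : Strategy n m → ℝ) (U : ℕ → Strategy n m)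
    (x : ℕ → ℝ) (T : ℕ) (v : Strategy n m) :
    ∏ e ∈ pathEdges v, edgeWeights γ η μ U x T e =
      Real.exp (∑ t ∈ Finset.range T,
        η * (estimate γ μ (edgeWeights γ η μ U x t) (U t) (x t) ⬝ᵥ charVec v)) := by
  induction T with
  | zero => simp [edgeWeights]
  | succ T ih => rw [prod_edgeWeights_succ, ih, Finset.sum_range_succ, Real.exp_add]

theorem one_le_numStrategies : 1 ≤ numStrategies n m := by
  rw [numStrategies]
  exact_mod_cast Fintype.card_pos (α := Strategy n m)

theorem sum_estimate_le (U : ℕ → Strategy n m) (x : ℕ → ℝ) (T : ℕ)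
    (h : ∀ t < T, ∀ v,
      |η * (estimate γ μ (edgeWeights γ η μ U x t) (U t) (x t) ⬝ᵥ charVec v)| ≤ 1)
    (v : Strategy n m) :
    ∑ t ∈ Finset.range T,
        η * (estimate γ μ (edgeWeights γ η μ U x t) (U t) (x t) ⬝ᵥ charVec v) ≤
      Real.log (numStrategies n m) +
        ∑ t ∈ Finset.range T, ∑ v, weightLaw (edgeWeights γ η μ U x t) v *
          (η * (estimate γ μ (edgeWeights γ η μ U x t) (U t) (x t) ⬝ᵥ charVec v) +
          (η * (estimate γ μ (edgeWeights γ η μ U x t) (U t) (x t) ⬝ᵥ charVec v)) ^ 2) := by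
  have hS : 0 < numStrategies n m := one_pos.trans_le one_le_numStrategies
  rw [← Real.exp_le_exp, Real.exp_add, Real.exp_log hS, ← prod_edgeWeights]
  refine le_trans ?_ (sum_prod_edgeWeights_le U x T h)
  exact Finset.single_le_sum (f := fun v => ∏ e ∈ pathEdges v, edgeWeights γ η μ U x T e)
    (fun v _ => Finset.prod_nonneg fun e _ => (edgeWeights_pos γ η μ U x T e).le)
    (Finset.mem_univ v)

/-- Substitute `(1 - γ) q = p - γ μ`. The first `p`-moment is exactly `x`, the second is at most `uᵀ
C⁺ u`, and the second `μ`-moment enters with a negative sign and is dropped. -/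
theorem weightLaw_moments_le (hn : 1 ≤ n) (hμ : μ ∈ stdSimplex ℝ (Strategy n m))
    (hexp : Exploratory μ) (hγ0 : 0 < γ) (hγ1 : γ ≤ 1) (hw : ∀ e, 0 < w e)
    (u : Strategy n m) {x : ℝ} (hx : x ∈ Set.Icc (0 : ℝ) 1) :
    (1 - γ) * ∑ v, weightLaw w v * (η * (estimate γ μ w u x ⬝ᵥ charVec v) +
        (η * (estimate γ μ w u x ⬝ᵥ charVec v)) ^ 2) ≤
      η * (x - γ * ∑ v, μ v * (estimate γ μ w u x ⬝ᵥ charVec v) +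
        η * (charVec u ⬝ᵥ pinv (cooccurrence (mixedLaw γ μ w)) *ᵥ charVec u)) := by
  have hd := dominates_mixedLaw hμ hexp hγ0 hγ1 hw
  have h1 : ∑ v, mixedLaw γ μ w v * (estimate γ μ w u x ⬝ᵥ charVec v) = x := by
    simp_rw [estimate_dotProduct, mul_left_comm _ x]
    rw [← Finset.mul_sum, hd.sum_eq_one hn, mul_one]
  have h2 : ∑ v, mixedLaw γ μ w v * (estimate γ μ w u x ⬝ᵥ charVec v) ^ 2 ≤
      charVec u ⬝ᵥ pinv (cooccurrence (mixedLaw γ μ w)) *ᵥ charVec u := by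
    simp_rw [estimate_dotProduct, mul_pow, mul_left_comm _ (x ^ 2)]
    rw [← Finset.mul_sum, hd.sum_sq]
    exact mul_le_of_le_one_left (hd.quadratic_nonneg u) (pow_le_one₀ hx.1 hx.2)
  have h3 : (1 - γ) * ∑ v, weightLaw w v * (η * (estimate γ μ w u x ⬝ᵥ charVec v) +
        (η * (estimate γ μ w u x ⬝ᵥ charVec v)) ^ 2) =
      η * (∑ v, mixedLaw γ μ w v * (estimate γ μ w u x ⬝ᵥ charVec v) -
        γ * ∑ v, μ v * (estimate γ μ w u x ⬝ᵥ charVec v)) +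
      η ^ 2 * (∑ v, mixedLaw γ μ w v * (estimate γ μ w u x ⬝ᵥ charVec v) ^ 2 -
        γ * ∑ v, μ v * (estimate γ μ w u x ⬝ᵥ charVec v) ^ 2) := by
    simp only [mixedLaw, Finset.mul_sum, ← Finset.sum_sub_distrib, ← Finset.sum_add_distrib]
    exact Finset.sum_congr rfl fun v _ => by ring
  have h4 : 0 ≤ γ * ∑ v, μ v * (estimate γ μ w u x ⬝ᵥ charVec v) ^ 2 :=
    mul_nonneg hγ0.le (Finset.sum_nonneg fun v _ => mul_nonneg (hμ.1 v) (sq_nonneg _))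
  rw [h3, h1]
  have := mul_le_mul_of_nonneg_left (sub_le_self _ h4 |>.trans h2) (sq_nonneg η)
  nlinarith

theorem abs_estimate_le (hμ : μ ∈ stdSimplex ℝ (Strategy n m)) (hexp : Exploratory μ)
    (hlam : IsLambdaStar μ lam) (hγ0 : 0 < γ) (hγ1 : γ ≤ 1)
    (hw : ∀ e, 0 < w e) (u v : Strategy n m) {x : ℝ} (hx : x ∈ Set.Icc (0 : ℝ) 1) :
    |estimate γ μ w u x ⬝ᵥ charVec v| ≤ n / (γ * lam) := by
  have hd := dominates_mixedLaw hμ hexp hγ0 hγ1 hw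
  rw [estimate_dotProduct, abs_mul, abs_of_nonneg hx.1]
  exact (mul_le_of_le_one_left (abs_nonneg _) hx.2).trans (hd.abs_bilinear_le hlam v u)

theorem hedge_bound (hn : 1 ≤ n) (hμ : μ ∈ stdSimplex ℝ (Strategy n m))
    (hexp : Exploratory μ) (hlam : IsLambdaStar μ lam) (hγ0 : 0 < γ) (hγ1 : γ ≤ 1) (hη : 0 < η)
    (hηγ : n / (γ * lam) = 1 / η) (U : ℕ → Strategy n m) (x : ℕ → ℝ) (T : ℕ)
    (hx : ∀ t < T, x t ∈ Set.Icc (0 : ℝ) 1) (v : Strategy n m) :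
    (1 - γ) * ∑ t ∈ Finset.range T,
        (estimate γ μ (edgeWeights γ η μ U x t) (U t) (x t) ⬝ᵥ charVec v) ≤
      Real.log (numStrategies n m) / η + ∑ t ∈ Finset.range T, x t -
        γ * ∑ v, μ v * ∑ t ∈ Finset.range T,
          (estimate γ μ (edgeWeights γ η μ U x t) (U t) (x t) ⬝ᵥ charVec v) +
        η * ∑ t ∈ Finset.range T, (charVec (U t) ⬝ᵥ
          pinv (cooccurrence (mixedLaw γ μ (edgeWeights γ η μ U x t))) *ᵥ charVec (U t)) := by
  have hw := edgeWeights_pos γ η μ U x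
  have h1 := sum_estimate_le (γ := γ) (η := η) (μ := μ) U x T (fun t ht v => by
    rw [abs_mul, abs_of_pos hη]
    have := mul_le_mul_of_nonneg_left
      (abs_estimate_le hμ hexp hlam hγ0 hγ1 (hw t) (U t) v (hx t ht)) hη.le
    rwa [hηγ, mul_one_div_cancel hη.ne'] at this) v
  have h2 := mul_le_mul_of_nonneg_left h1 (sub_nonneg.2 hγ1)
  have hL : 0 ≤ Real.log (numStrategies n m) := Real.log_nonneg one_le_numStrategies
  have h3 := Finset.sum_le_sum fun t ht => weightLaw_moments_le (η := η) hn hμ hexp hγ0 hγ1 (hw t)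
    (U t) (hx t (Finset.mem_range.1 ht))
  rw [← Finset.mul_sum] at h3
  simp only [← Finset.mul_sum] at h2 h3
  have h4 : ∑ v, μ v * ∑ t ∈ Finset.range T,
      (estimate γ μ (edgeWeights γ η μ U x t) (U t) (x t) ⬝ᵥ charVec v) =
      ∑ t ∈ Finset.range T, ∑ v, μ v *
        (estimate γ μ (edgeWeights γ η μ U x t) (U t) (x t) ⬝ᵥ charVec v) := by
    rw [Finset.sum_comm]
    simp only [Finset.mul_sum]
  rw [Finset.sum_add_distrib, Finset.sum_sub_distrib, ← Finset.mul_sum, ← Finset.mul_sum,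
    ← h4] at h3
  refine le_of_mul_le_mul_left ?_ hη
  have h5 : η * (Real.log (numStrategies n m) / η) = Real.log (numStrategies n m) := by
    field_simp
  have h6 : (1 - γ) * Real.log (numStrategies n m) ≤ Real.log (numStrategies n m) :=
    mul_le_of_le_one_left hL (by linarith)
  rw [mul_add] at h2
  rw [mul_add, mul_sub, mul_add, h5]
  linarith

end Weights

/-! ### Exponential supermartingales for a finitely valued sampled action -/

section Supermartingale

theorem measurable_eval_of_finite {α S : Type*} [MeasurableSpace α] [Fintype S]
    [MeasurableSpace S] [MeasurableSingletonClass S] {f : α → S → ℝ} {U : α → S}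
    (hf : ∀ u, Measurable fun a => f a u) (hU : Measurable U) :
    Measurable fun a => f a (U a) := by
  classical
  have h : (fun a => f a (U a)) = fun a => ∑ u, (U ⁻¹' {u}).indicator (fun a => f a u) a := by
    ext a
    rw [Finset.sum_eq_single (U a)]
    · simp
    · intro u _ hu
      refine Set.indicator_of_notMem (fun h : a ∈ U ⁻¹' {u} => ?_) _
      exact hu (Set.mem_singleton_iff.1 h).symm
    · simp
  rw [h]
  exact Finset.measurable_sum _ fun u _ => (hf u).indicator (hU (measurableSet_singleton u))

variable {Ω S : Type*} [mΩ : MeasurableSpace Ω] {P : Measure Ω} [IsProbabilityMeasure P]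
  [Fintype S] [MeasurableSpace S] [MeasurableSingletonClass S]

/-- One supermartingale step: split over the values of `U`, pull the `F`-measurable factor out of
the conditional expectation, and use the law `π`. -/
theorem integral_mul_eval_le {F : MeasurableSpace Ω} (hF : F ≤ mΩ) {U : Ω → S}
    (hU : Measurable[mΩ] U) {π : Ω → S → ℝ}
    (hlaw : ∀ u, P[Set.indicator {ω | U ω = u} (fun _ => (1 : ℝ)) | F] =ᵐ[P] fun ω => π ω u)
    {Z : Ω → ℝ} (hZ : Measurable[F] Z) (hZ0 : ∀ ω, 0 ≤ Z ω) {N : ℝ} (hZN : ∀ ω, Z ω ≤ N)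
    {g : Ω → S → ℝ} (hg : ∀ u, Measurable[F] fun ω => g ω u) (hg0 : ∀ ω u, 0 ≤ g ω u) {M : ℝ}
    (hgM : ∀ ω u, g ω u ≤ M) (hsum : ∀ ω, ∑ u, π ω u * g ω u ≤ 1) :
    ∫ ω, Z ω * g ω (U ω) ∂P ≤ ∫ ω, Z ω ∂P := by
  classical
  set H : S → Ω → ℝ := fun u ω => Z ω * g ω u with hH
  set I : S → Ω → ℝ := fun u => Set.indicator {ω | U ω = u} (fun _ => (1 : ℝ)) with hI
  have hHm : ∀ u, StronglyMeasurable[F] (H u) := fun u =>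
    (hZ.mul (hg u)).stronglyMeasurable
  have hHb : ∀ u, ∀ᵐ ω ∂P, ‖H u ω‖ ≤ N * M := fun u => ae_of_all _ fun ω => by
    rw [Real.norm_of_nonneg (mul_nonneg (hZ0 ω) (hg0 ω u))]
    exact mul_le_mul (hZN ω) (hgM ω u) (hg0 ω u) ((hZ0 ω).trans (hZN ω))
  have hIint : ∀ u, Integrable (I u) P := fun u =>
    (integrable_const (1 : ℝ)).indicator (hU (measurableSet_singleton u))
  have hHI : ∀ u, Integrable (H u * I u) P := fun u =>
    (hIint u).bdd_mul ((hHm u).mono hF).aestronglyMeasurable (hHb u)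
  have hcond : ∀ u, P[H u * I u | F] =ᵐ[P] fun ω => H u ω * π ω u := fun u => by
    filter_upwards [condExp_mul_of_stronglyMeasurable_left (hHm u) (hHI u) (hIint u), hlaw u]
      with ω h1 h2
    rw [h1, Pi.mul_apply, h2]
  have hsplit : ∀ ω, Z ω * g ω (U ω) = ∑ u, (H u * I u) ω := by
    intro ω
    rw [Finset.sum_eq_single (U ω)]
    · simp [hH, hI]
    · intro u _ hu
      simp [hI, Ne.symm hu]
    · simp
  have hπ : ∀ u, Integrable (fun ω => H u ω * π ω u) P := fun u =>
    integrable_condExp.congr (hcond u)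
  calc ∫ ω, Z ω * g ω (U ω) ∂P = ∫ ω, ∑ u, (H u * I u) ω ∂P := by simp_rw [hsplit]
    _ = ∑ u, ∫ ω, (H u * I u) ω ∂P := integral_finsetSum _ fun u _ => hHI u
    _ = ∑ u, ∫ ω, H u ω * π ω u ∂P := Finset.sum_congr rfl fun u _ => by
        rw [← integral_condExp hF, integral_congr_ae (hcond u)]
    _ = ∫ ω, ∑ u, H u ω * π ω u ∂P := (integral_finsetSum _ fun u _ => hπ u).symm
    _ ≤ ∫ ω, Z ω ∂P := by
        refine integral_mono (integrable_finsetSum _ fun u _ => hπ u) ?_ fun ω => ?_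
        · exact Integrable.of_bound (hZ.mono hF le_rfl).aestronglyMeasurable N
            (ae_of_all _ fun ω => by rw [Real.norm_of_nonneg (hZ0 ω)]; exact hZN ω)
        · have : ∑ u, H u ω * π ω u = Z ω * ∑ u, π ω u * g ω u := by
            rw [Finset.mul_sum]
            exact Finset.sum_congr rfl fun u _ => by simp only [hH]; ring
          rw [this]
          exact mul_le_of_le_one_right (hZ0 ω) (hsum ω)

/-- The exponentials of the partial sums have expectation at most `1`, and Markov's inequality
concludes. The bound `M` serves integrability only and does not enter the estimate. -/
theorem measureReal_sum_ge_le {F : ℕ → MeasurableSpace Ω} (hF : ∀ t, F t ≤ mΩ)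
    (hmono : ∀ t, F t ≤ F (t + 1)) {U : ℕ → Ω → S} (hU : ∀ t, Measurable[F (t + 1)] (U t))
    {T : ℕ} {π : ℕ → Ω → S → ℝ}
    (hlaw : ∀ t < T, ∀ u,
      P[Set.indicator {ω | U t ω = u} (fun _ => (1 : ℝ)) | F t] =ᵐ[P] fun ω => π t ω u)
    {f : ℕ → Ω → S → ℝ} (hf : ∀ t < T, ∀ u, Measurable[F t] fun ω => f t ω u) {M : ℝ}
    (hfM : ∀ t < T, ∀ ω u, f t ω u ≤ M)
    (hsum : ∀ t < T, ∀ ω, ∑ u, π t ω u * Real.exp (f t ω u) ≤ 1) (c : ℝ) :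
    P.real {ω | c ≤ ∑ t ∈ Finset.range T, f t ω (U t ω)} ≤ Real.exp (-c) := by
  set Z : ℕ → Ω → ℝ := fun k ω => Real.exp (∑ t ∈ Finset.range k, f t ω (U t ω)) with hZ
  have hsucc : ∀ k ω, Z (k + 1) ω = Z k ω * Real.exp (f k ω (U k ω)) := fun k ω => by
    simp only [hZ, Finset.sum_range_succ, Real.exp_add]
  have hZpos : ∀ k ω, 0 ≤ Z k ω := fun k ω => (Real.exp_pos _).le
  have hZbound : ∀ k ≤ T, ∀ ω, Z k ω ≤ Real.exp (k * M) := by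
    intro k hk ω
    refine Real.exp_le_exp.2 ?_
    calc ∑ t ∈ Finset.range k, f t ω (U t ω) ≤ ∑ _t ∈ Finset.range k, M :=
          Finset.sum_le_sum fun t ht => hfM t ((Finset.mem_range.1 ht).trans_le hk) ω _
      _ = k * M := by simp
  have hZmeas : ∀ k ≤ T, Measurable[F k] (Z k) := by
    intro k
    induction k with
    | zero => intro _; simp only [hZ, Finset.range_zero, Finset.sum_empty]; exact measurable_const
    | succ k ih =>
      intro hk
      have h1 : Measurable[F (k + 1)] (Z k) := (ih (by omega)).mono (hmono k) le_rfl
      have h2 : Measurable[F (k + 1)] fun ω => f k ω (U k ω) :=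
        @measurable_eval_of_finite Ω S (F (k + 1)) _ _ _ (f k) (U k)
          (fun u => (hf k (by omega) u).mono (hmono k) le_rfl) (hU k)
      have h3 : Z (k + 1) = fun ω => Z k ω * Real.exp (f k ω (U k ω)) := funext (hsucc k)
      rw [h3]
      exact h1.mul (Real.measurable_exp.comp h2)
  have hZint : ∀ k ≤ T, ∫ ω, Z k ω ∂P ≤ 1 := by
    intro k
    induction k with
    | zero => intro _; simp [hZ]
    | succ k ih =>
      intro hk
      refine le_trans ?_ (ih (by omega))
      simp_rw [hsucc]
      exact integral_mul_eval_le (hF k) ((hU k).mono (hF (k + 1)) le_rfl) (hlaw k (by omega))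
        (hZmeas k (by omega)) (hZpos k) (hZbound k (by omega))
        (g := fun ω u => Real.exp (f k ω u))
        (fun u => Real.measurable_exp.comp (hf k (by omega) u)) (fun _ _ => (Real.exp_pos _).le)
        (fun ω u => Real.exp_le_exp.2 (hfM k (by omega) ω u)) (hsum k (by omega))
  have hint : Integrable (Z T) P :=
    Integrable.of_bound ((hZmeas T le_rfl).mono (hF T) le_rfl).aestronglyMeasurable
      (Real.exp (T * M)) (ae_of_all _ fun ω => by
        rw [Real.norm_of_nonneg (hZpos T ω)]; exact hZbound T le_rfl ω)
  have hmarkov := mul_meas_ge_le_integral_of_nonneg (ae_of_all _ (hZpos T)) hint (Real.exp c)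
  have hset : {ω | Real.exp c ≤ Z T ω} = {ω | c ≤ ∑ t ∈ Finset.range T, f t ω (U t ω)} := by
    ext ω; simp [hZ]
  rw [hset] at hmarkov
  rw [Real.exp_neg, ← one_div, le_div_iff₀ (Real.exp_pos c), mul_comm]
  exact hmarkov.trans (hZint T le_rfl)

end Supermartingale

/-! ### Measurability of the algorithm with respect to the history -/

section Measurability

theorem measurable_det {α ι : Type*} [MeasurableSpace α] [Fintype ι] [DecidableEq ι]
    {A : α → Matrix ι ι ℝ} (hA : ∀ i j, Measurable fun a => A a i j) :
    Measurable fun a => (A a).det := by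
  simp only [det_apply']
  exact Finset.measurable_sum _ fun σ _ => measurable_const.mul
    (Finset.measurable_prod _ fun i _ => hA _ _)

theorem measurable_matrix_inv {α ι : Type*} [MeasurableSpace α] [Fintype ι] [DecidableEq ι]
    {A : α → Matrix ι ι ℝ} (hA : ∀ i j, Measurable fun a => A a i j) (i j : ι) :
    Measurable fun a => (A a)⁻¹ i j := by
  simp only [inv_def, Matrix.smul_apply, smul_eq_mul, Ring.inverse_eq_inv']
  refine (measurable_det hA).inv.mul ?_
  simp only [adjugate_apply]
  refine measurable_det fun k l => ?_
  simp only [updateRow_apply]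
  split_ifs
  · exact measurable_const
  · exact hA k l

variable {n m : ℕ} {μ : Strategy n m → ℝ} {γ : ℝ}

theorem measurable_mixedLaw {α : Type*} [MeasurableSpace α] {W : α → Edge n m → ℝ}
    (hW : ∀ e, Measurable fun a => W a e) (u : Strategy n m) :
    Measurable fun a => mixedLaw γ μ (W a) u := by
  have hprod : ∀ v : Strategy n m, Measurable fun a => ∏ e ∈ pathEdges v, W a e := fun v =>
    Finset.measurable_prod _ fun e _ => hW e
  simp only [mixedLaw, weightLaw]
  exact (measurable_const.mul ((hprod u).div
    (Finset.measurable_sum _ fun v _ => hprod v))).add measurable_const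

/-- The projection onto the range does not depend on the weights, so the pseudoinverse is an
ordinary inverse up to constant matrices, and Cramer's rule applies. -/
theorem measurable_pinv_mixedLaw {α : Type*} [MeasurableSpace α]
    (hμ : μ ∈ stdSimplex ℝ (Strategy n m)) (hexp : Exploratory μ) (hγ0 : 0 < γ) (hγ1 : γ ≤ 1)
    {W : α → Edge n m → ℝ} (hW : ∀ e, Measurable fun a => W a e) (hpos : ∀ a e, 0 < W a e)
    (i j : Edge n m) :
    Measurable fun a => pinv (cooccurrence (mixedLaw γ μ (W a))) i j := by
  classical
  have h : ∀ a, pinv (cooccurrence (mixedLaw γ μ (W a))) =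
      (cooccurrence (mixedLaw γ μ (W a)) + (1 - cooccurrence μ * pinv (cooccurrence μ)))⁻¹ -
        (1 - cooccurrence μ * pinv (cooccurrence μ)) := fun a => by
    rw [← (dominates_mixedLaw hμ hexp hγ0 hγ1 (hpos a)).projection_eq]
    exact pinv_eq_inv_sub (isHermitian_cooccurrence _)
  simp only [h, Matrix.sub_apply]
  refine (measurable_matrix_inv (fun k l => ?_) i j).sub measurable_const
  simp only [Matrix.add_apply]
  refine Measurable.add ?_ measurable_const
  simp only [cooccurrence, Matrix.sum_apply, Matrix.smul_apply, smul_eq_mul]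
  exact Finset.measurable_sum _ fun u _ => (measurable_mixedLaw hW u).mul measurable_const

theorem measurable_bilinear {α : Type*} [MeasurableSpace α]
    (hμ : μ ∈ stdSimplex ℝ (Strategy n m)) (hexp : Exploratory μ) (hγ0 : 0 < γ) (hγ1 : γ ≤ 1)
    {W : α → Edge n m → ℝ} (hW : ∀ e, Measurable fun a => W a e) (hpos : ∀ a e, 0 < W a e)
    (x y : Edge n m → ℝ) :
    Measurable fun a => x ⬝ᵥ pinv (cooccurrence (mixedLaw γ μ (W a))) *ᵥ y := by
  simp only [dotProduct, mulVec]
  exact Finset.measurable_sum _ fun i _ => measurable_const.mul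
    (Finset.measurable_sum _ fun j _ =>
      (measurable_pinv_mixedLaw hμ hexp hγ0 hγ1 hW hpos i j).mul measurable_const)

variable {Ω : Type*} {r : ℕ → Ω → Strategy n m → ℝ} {U : ℕ → Ω → Strategy n m}

theorem history_mono (r : ℕ → Ω → Strategy n m → ℝ) (U : ℕ → Ω → Strategy n m) (t : ℕ) :
    history r U t ≤ history r U (t + 1) :=
  sup_le_sup (biSup_mono fun _ h => Set.mem_Iic.2 ((Set.mem_Iic.1 h).trans t.le_succ))
    (biSup_mono fun _ h => Set.mem_Iio.2 ((Set.mem_Iio.1 h).trans t.lt_succ_self))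

theorem measurable_reward_history (r : ℕ → Ω → Strategy n m → ℝ) (U : ℕ → Ω → Strategy n m)
    (t : ℕ) (u : Strategy n m) : Measurable[history r U t] fun ω => r t ω u := by
  have h : MeasurableSpace.comap (r t) inferInstance ≤ history r U t :=
    le_sup_of_le_left (le_iSup₂_of_le t (Set.mem_Iic.2 le_rfl) le_rfl)
  have h1 : Measurable[history r U t] (r t) := (comap_measurable (r t)).mono h le_rfl
  exact (measurable_pi_apply u).comp h1

theorem measurable_path_history (r : ℕ → Ω → Strategy n m → ℝ) (U : ℕ → Ω → Strategy n m)
    (t : ℕ) : Measurable[history r U (t + 1)] (U t) := by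
  have h : MeasurableSpace.comap (U t) inferInstance ≤ history r U (t + 1) :=
    le_sup_of_le_right (le_iSup₂_of_le t (Set.mem_Iio.2 t.lt_succ_self) le_rfl)
  exact (comap_measurable (U t)).mono h le_rfl

theorem history_le [mΩ : MeasurableSpace Ω] (hr : ∀ t, Measurable (r t))
    (hU : ∀ t, Measurable (U t)) (t : ℕ) : history r U t ≤ mΩ :=
  sup_le (iSup₂_le fun s _ => (hr s).comap_le) (iSup₂_le fun s _ => (hU s).comap_le)

/-- The weights of round `t` use only rounds before `t`, whereas `U t` becomes measurable only at
index `t + 1`; this makes the deviation terms predictable. -/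
theorem measurable_edgeWeights_history (hμ : μ ∈ stdSimplex ℝ (Strategy n m))
    (hexp : Exploratory μ) (hγ0 : 0 < γ) (hγ1 : γ ≤ 1) (η : ℝ)
    (r : ℕ → Ω → Strategy n m → ℝ) (U : ℕ → Ω → Strategy n m) (t : ℕ) (e : Edge n m) :
    Measurable[history r U t] fun ω =>
      edgeWeights γ η μ (fun s => U s ω) (fun s => r s ω (U s ω)) t e := by
  induction t generalizing e with
  | zero => exact measurable_const
  | succ t ih =>
    have ih' : ∀ e, Measurable[history r U (t + 1)] fun ω =>
        edgeWeights γ η μ (fun s => U s ω) (fun s => r s ω (U s ω)) t e := fun e =>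
      (ih e).mono (history_mono r U t) le_rfl
    simp only [edgeWeights]
    split_ifs
    · exact ih' e
    · refine (ih' e).mul (Real.measurable_exp.comp (measurable_const.mul ?_))
      refine @measurable_eval_of_finite Ω (Strategy n m) (history r U (t + 1)) _ _ _
        (fun ω u => estimate γ μ
          (edgeWeights γ η μ (fun s => U s ω) (fun s => r s ω (U s ω)) t) u (r t ω u) e)
        (U t) (fun u => ?_) (measurable_path_history r U t)
      simp only [estimate, Pi.smul_apply, smul_eq_mul, mulVec, dotProduct]
      refine ((measurable_reward_history r U t u).mono (history_mono r U t) le_rfl).mul ?_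
      refine Finset.measurable_sum _ fun j _ => Measurable.mul ?_ measurable_const
      exact @measurable_pinv_mixedLaw n m μ γ Ω (history r U (t + 1)) hμ hexp hγ0 hγ1 _ ih'
        (fun ω e => edgeWeights_pos _ _ _ _ _ _ _) e j

end Measurability

/-! ### Deviation bounds for a run, and the regret on the good event -/

section Run

variable {n m T : ℕ} {μ : Strategy n m → ℝ} {γ η lam : ℝ} {w : Edge n m → ℝ}

/-- The estimate has mean `R`, second moment at most `1 / η`, and `a` times it is at most `1` in
absolute value; `a ^ 2 / η` compensates the quadratic term of the exponential. -/
theorem sum_mixedLaw_exp_estimate_le (hμ : μ ∈ stdSimplex ℝ (Strategy n m))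
    (hexp : Exploratory μ) (hlam : IsLambdaStar μ lam) (hγ0 : 0 < γ) (hγ1 : γ ≤ 1) (hη : 0 < η)
    (hηγ : n / (γ * lam) = 1 / η) (hw : ∀ e, 0 < w e) (ℓ : Edge n m → ℝ)
    (hℓ : ∀ u, ℓ ⬝ᵥ charVec u ∈ Set.Icc (0 : ℝ) 1) {a : ℝ} (ha : 0 < a) (haη : a ≤ η)
    (v : Strategy n m) :
    ∑ u, mixedLaw γ μ w u * Real.exp (a * (ℓ ⬝ᵥ charVec v) -
      a * (estimate γ μ w u (ℓ ⬝ᵥ charVec u) ⬝ᵥ charVec v) - a ^ 2 / η) ≤ 1 := by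
  have hd := dominates_mixedLaw hμ hexp hγ0 hγ1 hw
  set x := fun u => estimate γ μ w u (ℓ ⬝ᵥ charVec u) ⬝ᵥ charVec v with hx
  set R := ℓ ⬝ᵥ charVec v with hR
  have hmean : ∑ u, mixedLaw γ μ w u * x u = R := by
    rw [hR, ← hd.sum_bilinear ℓ v]
    refine Finset.sum_congr rfl fun u _ => ?_
    rw [hx]
    simp only [estimate_dotProduct]
    rw [dotProduct_pinv_comm]
  have hsq : ∑ u, mixedLaw γ μ w u * x u ^ 2 ≤ 1 / η := by
    rw [← hηγ]
    refine le_trans ?_ ((hd.sum_sq v).trans_le (hd.quadratic_le hlam v))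
    refine Finset.sum_le_sum fun u _ => mul_le_mul_of_nonneg_left ?_ (hd.law_nonneg u)
    rw [hx]
    simp only [estimate_dotProduct]
    rw [dotProduct_pinv_comm, mul_pow]
    exact mul_le_of_le_one_left (sq_nonneg _) (pow_le_one₀ (hℓ u).1 (hℓ u).2)
  have hsmall : ∀ u, |-(a * x u)| ≤ 1 := by
    intro u
    rw [abs_neg, abs_mul, abs_of_pos ha]
    have h1 := abs_estimate_le hμ hexp hlam hγ0 hγ1 hw u v (hℓ u)
    rw [hηγ] at h1
    calc a * |x u| ≤ η * (1 / η) := mul_le_mul haη h1 (abs_nonneg _) hη.le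
      _ = 1 := mul_one_div_cancel hη.ne'
  have h1 : ∑ u, mixedLaw γ μ w u * Real.exp (-(a * x u)) ≤ Real.exp (-(a * R) + a ^ 2 / η) := by
    calc ∑ u, mixedLaw γ μ w u * Real.exp (-(a * x u))
        ≤ ∑ u, mixedLaw γ μ w u * (1 + -(a * x u) + (-(a * x u)) ^ 2) :=
          Finset.sum_le_sum fun u _ =>
            mul_le_mul_of_nonneg_left (exp_le_one_add_add_sq (hsmall u)) (hd.law_nonneg u)
      _ = ∑ u, mixedLaw γ μ w u - a * ∑ u, mixedLaw γ μ w u * x u +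
            a ^ 2 * ∑ u, mixedLaw γ μ w u * x u ^ 2 := by
          rw [Finset.mul_sum, Finset.mul_sum, ← Finset.sum_sub_distrib, ← Finset.sum_add_distrib]
          exact Finset.sum_congr rfl fun u _ => by ring
      _ ≤ (-(a * R) + a ^ 2 / η) + 1 := by
          rw [sum_mixedLaw hμ hw, hmean]
          have := mul_le_mul_of_nonneg_left hsq (sq_nonneg a)
          rw [mul_one_div] at this
          linarith
      _ ≤ _ := Real.add_one_le_exp _
  calc ∑ u, mixedLaw γ μ w u * Real.exp (a * R - a * x u - a ^ 2 / η)
      = Real.exp (a * R - a ^ 2 / η) * ∑ u, mixedLaw γ μ w u * Real.exp (-(a * x u)) := by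
        rw [Finset.mul_sum]
        refine Finset.sum_congr rfl fun u _ => ?_
        rw [mul_left_comm, ← Real.exp_add]
        ring_nf
    _ ≤ Real.exp (a * R - a ^ 2 / η) * Real.exp (-(a * R) + a ^ 2 / η) :=
        mul_le_mul_of_nonneg_left h1 (Real.exp_pos _).le
    _ = 1 := by rw [← Real.exp_add]; simp

/-- For `y ∈ [0, 1]` one has `exp y ≤ 1 + 2y`, so the mean bound `E` alone controls the exponential
moment, at the price of the factor `2`. -/
theorem sum_mixedLaw_exp_quadratic_le (hμ : μ ∈ stdSimplex ℝ (Strategy n m))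
    (hexp : Exploratory μ) (hlam : IsLambdaStar μ lam) (hγ0 : 0 < γ) (hγ1 : γ ≤ 1) (hη : 0 < η)
    (hηγ : n / (γ * lam) = 1 / η) (hw : ∀ e, 0 < w e) :
    ∑ u, mixedLaw γ μ w u * Real.exp (η * (charVec u ⬝ᵥ
      pinv (cooccurrence (mixedLaw γ μ w)) *ᵥ charVec u) - 2 * η * numEdges n m) ≤ 1 := by
  have hd := dominates_mixedLaw hμ hexp hγ0 hγ1 hw
  set x := fun u => charVec u ⬝ᵥ pinv (cooccurrence (mixedLaw γ μ w)) *ᵥ charVec u with hx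
  have hx0 : ∀ u, 0 ≤ η * x u := fun u => mul_nonneg hη.le (hd.quadratic_nonneg u)
  have hx1 : ∀ u, η * x u ≤ 1 := fun u => by
    have h1 := mul_le_mul_of_nonneg_left (hd.quadratic_le hlam u) hη.le
    rwa [hηγ, mul_one_div_cancel hη.ne'] at h1
  have hexpx : ∀ u, Real.exp (η * x u) ≤ 1 + 2 * (η * x u) := fun u => by
    have h1 := exp_le_one_add_add_sq (x := η * x u) (by rw [abs_of_nonneg (hx0 u)]; exact hx1 u)
    nlinarith [hx0 u, hx1 u]
  have h1 : ∑ u, mixedLaw γ μ w u * Real.exp (η * x u) ≤ Real.exp (2 * η * numEdges n m) := by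
    calc ∑ u, mixedLaw γ μ w u * Real.exp (η * x u)
        ≤ ∑ u, mixedLaw γ μ w u * (1 + 2 * (η * x u)) :=
          Finset.sum_le_sum fun u _ => mul_le_mul_of_nonneg_left (hexpx u) (hd.law_nonneg u)
      _ = ∑ u, mixedLaw γ μ w u + 2 * η * ∑ u, mixedLaw γ μ w u * x u := by
          rw [Finset.mul_sum, ← Finset.sum_add_distrib]
          exact Finset.sum_congr rfl fun u _ => by ring
      _ ≤ 2 * η * numEdges n m + 1 := by
          rw [sum_mixedLaw hμ hw]
          have := mul_le_mul_of_nonneg_left (sum_quadratic_le (mixedLaw γ μ w))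
            (by positivity : 0 ≤ 2 * η)
          linarith
      _ ≤ _ := Real.add_one_le_exp _
  calc ∑ u, mixedLaw γ μ w u * Real.exp (η * x u - 2 * η * numEdges n m)
      = Real.exp (-(2 * η * numEdges n m)) * ∑ u, mixedLaw γ μ w u * Real.exp (η * x u) := by
        rw [Finset.mul_sum]
        refine Finset.sum_congr rfl fun u _ => ?_
        rw [mul_left_comm, ← Real.exp_add]
        ring_nf
    _ ≤ Real.exp (-(2 * η * numEdges n m)) * Real.exp (2 * η * numEdges n m) :=
        mul_le_mul_of_nonneg_left h1 (Real.exp_pos _).le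
    _ = 1 := by rw [← Real.exp_add]; simp

variable {Ω : Type*} [MeasurableSpace Ω] {P : Measure Ω} [IsProbabilityMeasure P]
  {r : ℕ → Ω → Strategy n m → ℝ} {U : ℕ → Ω → Strategy n m}

theorem measureReal_estimate_ge_le (hμ : μ ∈ stdSimplex ℝ (Strategy n m))
    (hexp : Exploratory μ) (hlam : IsLambdaStar μ lam) (hγ0 : 0 < γ) (hγ1 : γ ≤ 1) (hη : 0 < η)
    (hηγ : n / (γ * lam) = 1 / η) (hrun : IsEdgeRun P T γ η μ r U)
    {ℓ : ℕ → Ω → Edge n m → ℝ} (hℓ : ∀ t < T, ∀ ω u, r t ω u = ℓ t ω ⬝ᵥ charVec u)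
    (hr : ∀ t < T, ∀ ω u, r t ω u ∈ Set.Icc (0 : ℝ) 1) {a : ℝ} (ha : 0 < a) (haη : a ≤ η)
    (v : Strategy n m) (c : ℝ) :
    P.real {ω | c ≤ ∑ t ∈ Finset.range T, (a * r t ω v - a * (estimate γ μ
      (edgeWeights γ η μ (fun s => U s ω) (fun s => r s ω (U s ω)) t) (U t ω) (r t ω (U t ω))
        ⬝ᵥ charVec v) - a ^ 2 / η)} ≤ Real.exp (-c) := by
  have hF := history_le hrun.measurable_reward hrun.measurable_path
  refine measureReal_sum_ge_le hF (history_mono r U) (measurable_path_history r U) hrun.path_law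
    (f := fun t ω u => a * r t ω v - a * (estimate γ μ
      (edgeWeights γ η μ (fun s => U s ω) (fun s => r s ω (U s ω)) t) u (r t ω u)
        ⬝ᵥ charVec v) - a ^ 2 / η) (M := a + a * (1 / η)) ?_ ?_ ?_ c
  · intro t _ u
    have h1 := measurable_reward_history r U t
    have h2 := @measurable_bilinear n m μ γ Ω (history r U t) hμ hexp hγ0 hγ1 _
      (measurable_edgeWeights_history hμ hexp hγ0 hγ1 η r U t)
      (fun ω e => edgeWeights_pos _ _ _ _ _ _ _) (charVec v) (charVec u)
    simp only [estimate_dotProduct]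
    exact (((h1 v).const_mul a).sub (((h1 u).mul h2).const_mul a)).sub_const _
  · intro t ht ω u
    have h1 := abs_estimate_le hμ hexp hlam hγ0 hγ1
      (edgeWeights_pos γ η μ (fun s => U s ω) (fun s => r s ω (U s ω)) t) u v (hr t ht ω u)
    rw [hηγ] at h1
    have h2 := mul_le_mul_of_nonneg_left (neg_le.1 (abs_le.1 h1).1) ha.le
    have h3 := mul_le_mul_of_nonneg_left (hr t ht ω v).2 ha.le
    have h4 : 0 ≤ a ^ 2 / η := by positivity
    linarith
  · intro t ht ω
    simp only [hℓ t ht ω]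
    exact sum_mixedLaw_exp_estimate_le hμ hexp hlam hγ0 hγ1 hη hηγ
      (edgeWeights_pos _ _ _ _ _ _) (ℓ t ω) (fun u => hℓ t ht ω u ▸ hr t ht ω u) ha haη v

theorem measureReal_quadratic_ge_le (hμ : μ ∈ stdSimplex ℝ (Strategy n m))
    (hexp : Exploratory μ) (hlam : IsLambdaStar μ lam) (hγ0 : 0 < γ) (hγ1 : γ ≤ 1) (hη : 0 < η)
    (hηγ : n / (γ * lam) = 1 / η) (hrun : IsEdgeRun P T γ η μ r U) (c : ℝ) :
    P.real {ω | c ≤ ∑ t ∈ Finset.range T, (η * (charVec (U t ω) ⬝ᵥ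
      pinv (cooccurrence (mixedLaw γ μ
        (edgeWeights γ η μ (fun s => U s ω) (fun s => r s ω (U s ω)) t))) *ᵥ charVec (U t ω)) -
        2 * η * numEdges n m)} ≤ Real.exp (-c) := by
  have hF := history_le hrun.measurable_reward hrun.measurable_path
  refine measureReal_sum_ge_le hF (history_mono r U) (measurable_path_history r U) hrun.path_law
    (f := fun t ω u => η * (charVec u ⬝ᵥ
      pinv (cooccurrence (mixedLaw γ μ
        (edgeWeights γ η μ (fun s => U s ω) (fun s => r s ω (U s ω)) t))) *ᵥ charVec u) -
        2 * η * numEdges n m) (M := 1) ?_ ?_ ?_ c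
  · intro t _ u
    have h2 := @measurable_bilinear n m μ γ Ω (history r U t) hμ hexp hγ0 hγ1 _
      (measurable_edgeWeights_history hμ hexp hγ0 hγ1 η r U t)
      (fun ω e => edgeWeights_pos _ _ _ _ _ _ _) (charVec u) (charVec u)
    exact (h2.const_mul η).sub_const _
  · intro t ht ω u
    have hd := dominates_mixedLaw hμ hexp hγ0 hγ1
      (edgeWeights_pos γ η μ (fun s => U s ω) (fun s => r s ω (U s ω)) t)
    have h1 := mul_le_mul_of_nonneg_left (hd.quadratic_le hlam u) hη.le
    rw [hηγ, mul_one_div_cancel hη.ne'] at h1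
    have h2 : 0 ≤ 2 * η * numEdges n m := by rw [numEdges]; positivity
    linarith
  · intro t _ ω
    exact sum_mixedLaw_exp_quadratic_le hμ hexp hlam hγ0 hγ1 hη hηγ (edgeWeights_pos _ _ _ _ _ _)

theorem regret_le {R : ℕ → Strategy n m → ℝ} {V : ℕ → Strategy n m}
    (hn : 1 ≤ n) (hμ : μ ∈ stdSimplex ℝ (Strategy n m))
    (hexp : Exploratory μ) (hlam : IsLambdaStar μ lam) (hγ0 : 0 < γ) (hγ1 : γ ≤ 1) (hη : 0 < η)
    (hηγ : n / (γ * lam) = 1 / η) (hR : ∀ t < T, ∀ u, R t u ∈ Set.Icc (0 : ℝ) 1)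
    {D Q : ℝ}
    (hD : ∀ v, ∑ t ∈ Finset.range T, R t v - ∑ t ∈ Finset.range T, (estimate γ μ
      (edgeWeights γ η μ V (fun s => R s (V s)) t) (V t) (R t (V t)) ⬝ᵥ charVec v) ≤ D)
    (hQ : η * ∑ t ∈ Finset.range T, (charVec (V t) ⬝ᵥ
      pinv (cooccurrence (mixedLaw γ μ (edgeWeights γ η μ V (fun s => R s (V s)) t))) *ᵥ
        charVec (V t)) ≤ Q) :
    regret T R V ≤ γ * T + D + Real.log (numStrategies n m) / η + Q := by
  rw [regret, sub_le_iff_le_add]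
  refine ciSup_le fun v => ?_
  have h1 := hedge_bound hn hμ hexp hlam hγ0 hγ1 hη hηγ V (fun s => R s (V s)) T
    (fun t ht => hR t ht _) v
  set G := fun v => ∑ t ∈ Finset.range T, (estimate γ μ
      (edgeWeights γ η μ V (fun s => R s (V s)) t) (V t) (R t (V t)) ⬝ᵥ charVec v) with hG
  -- Nonnegative rewards turn the deviation bound into a lower bound on the estimates. The
  -- exploration term then costs `γ D`, which adds to `(1 - γ) D` to give just `D`.
  have h2 : -D ≤ ∑ v, μ v * G v := by
    calc -D = ∑ v, μ v * -D := by rw [← Finset.sum_mul, hμ.2, one_mul]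
      _ ≤ _ := Finset.sum_le_sum fun v _ => mul_le_mul_of_nonneg_left (by
          have h3 : 0 ≤ ∑ t ∈ Finset.range T, R t v :=
            Finset.sum_nonneg fun t ht => (hR t (Finset.mem_range.1 ht) v).1
          have := hD v
          simp only [hG]
          linarith) (hμ.1 v)
  have h3 : ∑ t ∈ Finset.range T, R t v ≤ T := by
    calc ∑ t ∈ Finset.range T, R t v ≤ ∑ _t ∈ Finset.range T, (1 : ℝ) :=
          Finset.sum_le_sum fun t ht => (hR t (Finset.mem_range.1 ht) v).2
      _ = T := by simp
  have h4 := mul_le_mul_of_nonneg_left (hD v) (sub_nonneg.2 hγ1)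
  have h5 := mul_le_mul_of_nonneg_left h2 hγ0.le
  have h6 := mul_le_mul_of_nonneg_left h3 hγ0.le
  simp only [hG] at h5
  linarith

end Run

/-! ### Arithmetic of the rates -/

section Rates

/-- With `b² = B`, `l² = ln S`, `l'² = ln (S / δ)` and `τ³ = T`, all terms of the regret bound
are of the order `τ² b l'`, unless `T` itself is. -/
theorem rate_bound {b l l' τ K E c : ℝ} (hb : 1 ≤ b) (hl : 0 < l) (hll : l ≤ l')
    (hbl : 1 ≤ b * l) (hτ : 1 ≤ τ) (hK : K ≤ b ^ 2) (hE : E ≤ b ^ 2)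
    (hc : c ≤ l' ^ 2) (hcase : l' ^ 2 * b ≤ l * τ ^ 2) :
    K * (l / (b * τ)) * τ ^ 3 +
      (l' / (τ ^ 2 * b) * τ ^ 3 / (l / (b * τ)) + l' ^ 2 / (l' / (τ ^ 2 * b))) +
      l ^ 2 / (l / (b * τ)) + (2 * (l / (b * τ)) * E * τ ^ 3 + c) ≤ 7 * (τ ^ 2 * (b * l')) := by
  have hb0 : 0 < b := by linarith
  have hτ0 : 0 < τ := by linarith
  have hl'0 : 0 < l' := by linarith
  have hmain : ∀ {X : ℝ}, X ≤ b ^ 2 → X * (l / (b * τ)) * τ ^ 3 ≤ τ ^ 2 * (b * l') := by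
    intro X hX
    calc X * (l / (b * τ)) * τ ^ 3 ≤ b ^ 2 * (l' / (b * τ)) * τ ^ 3 := by gcongr
      _ = τ ^ 2 * (b * l') := by field_simp
  have h1 := hmain hK
  have h2 := hmain hE
  have h3 : l' / (τ ^ 2 * b) * τ ^ 3 / (l / (b * τ)) ≤ τ ^ 2 * (b * l') := by
    have : l' / (τ ^ 2 * b) * τ ^ 3 / (l / (b * τ)) = τ ^ 2 * l' / l := by field_simp
    rw [this, div_le_iff₀ hl]
    have : 0 ≤ τ ^ 2 * l' := by positivity
    nlinarith
  have h4 : l' ^ 2 / (l' / (τ ^ 2 * b)) = τ ^ 2 * (b * l') := by field_simp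
  have h5 : l ^ 2 / (l / (b * τ)) ≤ τ ^ 2 * (b * l') := by
    have h : l ^ 2 / (l / (b * τ)) = τ * (b * l) := by field_simp
    rw [h]
    have : τ ≤ τ ^ 2 := by nlinarith
    gcongr
  have h6 : c ≤ τ ^ 2 * (b * l') := by
    calc c ≤ l' ^ 2 * 1 := by linarith
      _ ≤ l' ^ 2 * b := by gcongr
      _ ≤ l * τ ^ 2 := hcase
      _ ≤ l' * τ ^ 2 * 1 := by rw [mul_one]; gcongr
      _ ≤ l' * τ ^ 2 * b := by gcongr
      _ = _ := by ring
  have h7 : 2 * (l / (b * τ)) * E * τ ^ 3 = 2 * (E * (l / (b * τ)) * τ ^ 3) := by ring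
  -- The constant `7` counts the terms: `h1`, `h3`, `h4`, `h5`, `h6` once each and `h2` twice.
  rw [h4, h7]
  linarith

/-- This is the condition `a ≤ η` of the deviation bound; it reduces to `l' ≤ l * τ`. -/
theorem deviation_parameter_le {b l l' τ : ℝ} (hb : 1 ≤ b) (hl : 0 < l) (hll : l ≤ l')
    (hbl : 1 ≤ b * l) (hτ : 1 ≤ τ) (hcase : l' ^ 2 * b ≤ l * τ ^ 2) :
    l' / (τ ^ 2 * b) ≤ l / (b * τ) := by
  have hb0 : 0 < b := by linarith
  have hτ0 : 0 < τ := by linarith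
  have hl'0 : 0 < l' := by linarith
  have h1 : l' ≤ l * τ := by
    refine abs_le_of_sq_le_sq' ?_ (by positivity) |>.2
    calc l' ^ 2 ≤ l' ^ 2 * (b * l) := le_mul_of_one_le_right (by positivity) hbl
      _ = l' ^ 2 * b * l := by ring
      _ ≤ l * τ ^ 2 * l := by gcongr
      _ = (l * τ) ^ 2 := by ring
  rw [div_le_div_iff₀ (by positivity) (by positivity)]
  have := mul_le_mul_of_nonneg_right h1 (by positivity : 0 ≤ b * τ)
  linarith

/-- The complementary case: for such small `δ` the claimed rate is at least `T`. -/
theorem horizon_le {b l l' τ : ℝ} (hb : 1 ≤ b) (hl : 0 < l) (hll : l ≤ l') (hbl : 1 ≤ b * l)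
    (hτ : 1 ≤ τ) (hcase : l * τ ^ 2 ≤ l' ^ 2 * b) : τ ^ 3 ≤ τ ^ 2 * (b * l') := by
  have hb0 : 0 < b := by linarith
  have hl'0 : 0 < l' := by linarith
  have h1 : τ ≤ b * l' := by
    refine abs_le_of_sq_le_sq' ?_ (by positivity) |>.2
    calc τ ^ 2 ≤ τ ^ 2 * (b * l) := le_mul_of_one_le_right (by positivity) hbl
      _ = l * τ ^ 2 * b := by ring
      _ ≤ l' ^ 2 * b * b := by gcongr
      _ = (b * l') ^ 2 := by ring
  calc τ ^ 3 = τ ^ 2 * τ := by ring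
    _ ≤ _ := by gcongr

end Rates

/-! ### The high-probability regret bound -/

section Main

variable {n m T : ℕ} {μ : Strategy n m → ℝ} {lam δ : ℝ} {Ω : Type*} [MeasurableSpace Ω]
  {P : Measure Ω} [IsProbabilityMeasure P]
  {r : ℕ → Ω → Strategy n m → ℝ} {U : ℕ → Ω → Strategy n m}

theorem regret_le_horizon {R : ℕ → Strategy n m → ℝ} (V : ℕ → Strategy n m)
    (hR : ∀ t < T, ∀ u, R t u ∈ Set.Icc (0 : ℝ) 1) : regret T R V ≤ T := by
  rw [regret, sub_le_iff_le_add]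
  refine ciSup_le fun v => ?_
  have h1 : ∑ t ∈ Finset.range T, R t v ≤ ∑ _t ∈ Finset.range T, (1 : ℝ) :=
    Finset.sum_le_sum fun t ht => (hR t (Finset.mem_range.1 ht) v).2
  have h2 : 0 ≤ ∑ t ∈ Finset.range T, R t (V t) :=
    Finset.sum_nonneg fun t ht => (hR t (Finset.mem_range.1 ht) _).1
  simp only [Finset.sum_const, Finset.card_range, nsmul_eq_mul, mul_one] at h1
  linarith

theorem one_sub_le_measureReal_of_subset {s t : Set Ω} {ε : ℝ} (hst : sᶜ ⊆ t)
    (hs : P.real s ≤ ε) : 1 - ε ≤ P.real t := by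
  have h1 : P.real Set.univ ≤ P.real s + P.real t := by
    refine (measureReal_mono ?_).trans (measureReal_union_le s t)
    intro ω _
    by_cases h : ω ∈ s
    · exact Or.inl h
    · exact Or.inr (hst h)
  rw [probReal_univ] at h1
  linarith

theorem regret_high_probability (hn : 1 ≤ n) (hT : 1 ≤ T)
    (hμ : μ ∈ stdSimplex ℝ (Strategy n m)) (hexp : Exploratory μ) (hlam : IsLambdaStar μ lam)
    (hγ1 : gammaParam n m T lam ≤ 1) (hδ0 : 0 < δ) (hδ1 : δ < 1)
    (hrun : IsEdgeRun P T (gammaParam n m T lam) (etaParam n m T lam) μ r U)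
    {ℓ : ℕ → Ω → Edge n m → ℝ} (hℓ : ∀ t < T, ∀ ω u, r t ω u = ℓ t ω ⬝ᵥ charVec u)
    (hr : ∀ t < T, ∀ ω u, r t ω u ∈ Set.Icc (0 : ℝ) 1) :
    1 - 2 * δ ≤ P.real {ω | regret T (fun t => r t ω) (fun t => U t ω) ≤
      7 * regretRate n m T lam δ} := by
  have hsure : (∀ ω, regret T (fun t => r t ω) (fun t => U t ω) ≤ 7 * regretRate n m T lam δ) →
      1 - 2 * δ ≤ P.real {ω | regret T (fun t => r t ω) (fun t => U t ω) ≤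
        7 * regretRate n m T lam δ} := fun h =>
    one_sub_le_measureReal_of_subset (s := ∅) (fun ω _ => h ω) (by simp [hδ0.le])
  have hrate0 : 0 ≤ regretRate n m T lam δ := by rw [regretRate]; positivity
  -- For `m = 0` there is a single strategy, so `ln S`, `η` and `γ` vanish and the analysis of the
  -- estimates is void; the regret is then at most zero.
  rcases Nat.eq_zero_or_pos m with rfl | hm
  · refine hsure fun ω => ?_
    have := subsingleton_strategy (n := n)
    refine le_trans ?_ (mul_nonneg (by norm_num) hrate0)
    rw [regret, sub_nonpos]
    exact ciSup_le fun v => Finset.sum_le_sum fun t _ => (congrArg _ (Subsingleton.elim _ _)).le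
  have hlam0 := lambdaStar_pos hμ.1 hlam
  have hS := two_le_numStrategies hn hm
  have hE := two_le_numEdges hn hm
  have hn0 : (0 : ℝ) < n := by exact_mod_cast hn
  set E := numEdges n m with hEdef
  set S := numStrategies n m with hSdef
  have hS0 : 0 < S := by linarith
  have hB : (n / (E * lam) + 1) * E = n / lam + E := by field_simp
  set B := n / lam + E with hBdef
  have hK0 : 0 < n / lam := by positivity
  have hB2 : 2 ≤ B := by linarith
  set L := Real.log S with hLdef
  -- Together with `B ≥ 2` this yields `b * l ≥ 1`.
  have hlog2 : (1 / 2 : ℝ) ≤ L := by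
    have h1 : Real.log 2 ≤ L := Real.log_le_log (by norm_num) hS
    have := Real.log_two_gt_d9
    linarith
  set L' := Real.log (S / δ) with hL'def
  have hLL' : L' = L + Real.log (1 / δ) := by
    rw [hL'def, div_eq_mul_one_div, Real.log_mul hS0.ne' (by positivity)]
  have hδlog : 0 < Real.log (1 / δ) := Real.log_pos (by rw [lt_div_iff₀ hδ0]; linarith)
  set b := √B with hb
  set l := √L with hl
  set l' := √L' with hl'
  set τ := (T : ℝ) ^ (1 / 3 : ℝ) with hτ
  have hbsq : b ^ 2 = B := Real.sq_sqrt (by linarith)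
  have hlsq : l ^ 2 = L := Real.sq_sqrt (by linarith)
  have hl'sq : l' ^ 2 = L' := Real.sq_sqrt (by linarith)
  have hT1 : (1 : ℝ) ≤ T := by exact_mod_cast hT
  have hτ1 : 1 ≤ τ := Real.one_le_rpow hT1 (by norm_num)
  have hτ2 : (T : ℝ) ^ (2 / 3 : ℝ) = τ ^ 2 := by
    rw [hτ, ← Real.rpow_natCast, ← Real.rpow_mul (by linarith)]
    norm_num
  have hτ3 : (T : ℝ) = τ ^ 3 := by
    rw [hτ, ← Real.rpow_natCast, ← Real.rpow_mul (by linarith)]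
    norm_num
  have hb1 : 1 ≤ b := Real.one_le_sqrt.2 (by linarith)
  have hl0 : 0 < l := Real.sqrt_pos.2 (by linarith)
  have hll : l ≤ l' := Real.sqrt_le_sqrt (by linarith)
  have hbl : 1 ≤ b * l := by
    rw [hb, hl, ← Real.sqrt_mul (by linarith)]
    exact Real.one_le_sqrt.2 (by nlinarith)
  have hηeq : etaParam n m T lam = l / (b * τ) := by
    rw [etaParam, hB, hτ2, Real.sqrt_div (by linarith), Real.sqrt_mul (by linarith),
      Real.sqrt_sq (by linarith)]
  have hγeq : gammaParam n m T lam = n / lam * etaParam n m T lam := rfl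
  have hReq : regretRate n m T lam δ = τ ^ 2 * (b * l') := by
    rw [regretRate, hB, hτ2, Real.sqrt_mul (by linarith)]
  have hη0 : 0 < etaParam n m T lam := by rw [hηeq]; positivity
  have hγ0 : 0 < gammaParam n m T lam := by rw [hγeq]; positivity
  rcases le_total (l * τ ^ 2) (l' ^ 2 * b) with hcase | hcase
  · refine hsure fun ω => ?_
    have h1 := horizon_le hb1 hl0 hll hbl hτ1 hcase
    have h2 := regret_le_horizon (fun t => U t ω) (fun t ht u => hr t ht ω u)
    rw [← hτ3, ← hReq] at h1
    linarith
  have hηγ : n / (gammaParam n m T lam * lam) = 1 / etaParam n m T lam := by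
    rw [hγeq]; field_simp
  set η := etaParam n m T lam
  set γ := gammaParam n m T lam
  -- With this choice `L' / a` is exactly the target rate, and `a * T / η` stays below it because `b
  -- * l ≥ 1`.
  set a := l' / (τ ^ 2 * b) with ha
  have hl'0 : 0 < l' := hl0.trans_le hll
  have ha0 : 0 < a := by positivity
  have haη : a ≤ η := hηeq ▸ deviation_parameter_le hb1 hl0 hll hbl hτ1 hcase
  have hev1 := fun v => measureReal_estimate_ge_le hμ hexp hlam hγ0 hγ1 hη0 hηγ hrun hℓ hr ha0
    haη v L'
  -- A single event, so the level is `ln (1 / δ)`; the competitor events use `L' = ln (S / δ)` to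
  -- pay for the union over `S` paths.
  have hev2 := measureReal_quadratic_ge_le hμ hexp hlam hγ0 hγ1 hη0 hηγ hrun (Real.log (1 / δ))
  set A₁ : Strategy n m → Set Ω := fun v => {ω | L' ≤ ∑ t ∈ Finset.range T,
    (a * r t ω v - a * (estimate γ μ (edgeWeights γ η μ (fun s => U s ω)
      (fun s => r s ω (U s ω)) t) (U t ω) (r t ω (U t ω)) ⬝ᵥ charVec v) - a ^ 2 / η)} with hA₁
  set A₂ : Set Ω := {ω | Real.log (1 / δ) ≤ ∑ t ∈ Finset.range T, (η * (charVec (U t ω) ⬝ᵥ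
      pinv (cooccurrence (mixedLaw γ μ
        (edgeWeights γ η μ (fun s => U s ω) (fun s => r s ω (U s ω)) t))) *ᵥ charVec (U t ω)) -
        2 * η * E)} with hA₂
  refine one_sub_le_measureReal_of_subset (s := (⋃ v, A₁ v) ∪ A₂) ?_ ?_
  · intro ω hω
    simp only [Set.mem_compl_iff, Set.mem_union, Set.mem_iUnion, not_or, not_exists] at hω
    obtain ⟨hω1, hω2⟩ := hω
    have hD : ∀ v, ∑ t ∈ Finset.range T, r t ω v - ∑ t ∈ Finset.range T, (estimate γ μ
        (edgeWeights γ η μ (fun s => U s ω) (fun s => r s ω (U s ω)) t) (U t ω)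
          (r t ω (U t ω)) ⬝ᵥ charVec v) ≤ a * T / η + L' / a := by
      intro v
      have h1 := hω1 v
      rw [hA₁, Set.mem_ofPred_eq, not_le] at h1
      rw [Finset.sum_sub_distrib, Finset.sum_sub_distrib, ← Finset.mul_sum, ← Finset.mul_sum,
        Finset.sum_const, Finset.card_range, nsmul_eq_mul, ← mul_sub] at h1
      refine le_of_mul_le_mul_left ?_ ha0
      have h2 : a * (a * T / η + L' / a) = T * (a ^ 2 / η) + L' := by field_simp
      rw [h2]
      linarith
    have hQ : η * ∑ t ∈ Finset.range T, (charVec (U t ω) ⬝ᵥ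
        pinv (cooccurrence (mixedLaw γ μ
          (edgeWeights γ η μ (fun s => U s ω) (fun s => r s ω (U s ω)) t))) *ᵥ
          charVec (U t ω)) ≤ 2 * η * E * T + Real.log (1 / δ) := by
      have h1 := hω2
      rw [hA₂, Set.mem_ofPred_eq, not_le] at h1
      rw [Finset.sum_sub_distrib, ← Finset.mul_sum, Finset.sum_const, Finset.card_range,
        nsmul_eq_mul] at h1
      linarith
    have h1 := regret_le (R := fun t => r t ω) (V := fun t => U t ω) hn hμ hexp hlam hγ0 hγ1 hη0
      hηγ (fun t ht u => hr t ht ω u) hD hQ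
    have h2 := rate_bound (K := n / lam) (E := E) (c := Real.log (1 / δ)) hb1 hl0 hll hbl hτ1
      (by rw [hbsq]; linarith) (by rw [hbsq]; linarith) (by rw [hl'sq]; linarith) hcase
    rw [← hηeq, ← hτ3, ← hReq, ← ha, hl'sq, hlsq, ← hγeq] at h2
    exact h1.trans h2
  · have h1 : P.real (⋃ v, A₁ v) ≤ δ := by
      refine (measureReal_iUnion_fintype_le A₁).trans ?_
      refine (Finset.sum_le_sum fun v _ => hev1 v).trans ?_
      rw [Real.exp_neg, Real.exp_log (by positivity), Finset.sum_const, Finset.card_univ,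
        nsmul_eq_mul]
      change S * (S / δ)⁻¹ ≤ δ
      refine le_of_eq ?_
      field_simp
    have h2 : P.real A₂ ≤ δ := by
      refine hev2.trans (le_of_eq ?_)
      rw [Real.exp_neg, Real.exp_log (by positivity)]
      simp
    linarith [measureReal_union_le (μ := P) (⋃ v, A₁ v) A₂]

end Main

end ColonelBlotto


theorem theorem1 :
    ∃ C₁ C₂ : ℝ, 0 < C₁ ∧ 0 < C₂ ∧
      ∀ (n m T : ℕ), 1 ≤ n → 1 ≤ T →
      ∀ (μ : Strategy n m → ℝ), μ ∈ stdSimplex ℝ (Strategy n m) → Exploratory μ →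
      ∀ lam : ℝ, IsLambdaStar μ lam →
      gammaParam n m T lam ≤ 1 →
      ∀ δ : ℝ, 0 < δ → δ < 1 →
      ∀ (Ω : Type*) [MeasurableSpace Ω] (P : Measure Ω) [IsProbabilityMeasure P]
        (r : ℕ → Ω → Strategy n m → ℝ) (U : ℕ → Ω → Strategy n m),
        IsEdgeRun P T (gammaParam n m T lam) (etaParam n m T lam) μ r U →
        -- arbitrary vectors on the edges, with all path rewards in the unit interval
        ((∀ ℓ : ℕ → Ω → Edge n m → ℝ,
            (∀ t < T, ∀ ω u, r t ω u = ∑ e, ℓ t ω e * charVec u e) →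
            (∀ t < T, ∀ ω u, r t ω u ∈ Set.Icc (0 : ℝ) 1) →
            1 - C₁ * δ ≤ P.real {ω | regret T (fun t => r t ω) (fun t => U t ω) ≤
              C₂ * regretRate n m T lam δ}) ∧
        -- in particular, the payoffs of the Colonel Blotto game against any opponent
          (∀ (b : Fin n → ℝ) (v : ℕ → Ω → Fin n → ℕ),
            (∀ i, 0 < b i) → ∑ i, b i = 1 →
            (∀ t < T, ∀ ω u, r t ω u = payoff b u (v t ω)) →
            1 - C₁ * δ ≤ P.real {ω | regret T (fun t => r t ω) (fun t => U t ω) ≤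
              C₂ * regretRate n m T lam δ})) := by
  -- One `δ` for all competitors together and one for the quadratic sum.
  refine ⟨2, 7, by norm_num, by norm_num, ?_⟩
  intro n m T hn hT μ hμ hexp lam hlam hγ δ hδ0 hδ1 Ω _ P _ r U hrun
  refine ⟨fun ℓ hℓ hr => ?_, fun b v hb hsum hr => ?_⟩
  · exact regret_high_probability hn hT hμ hexp hlam hγ hδ0 hδ1 hrun hℓ hr
  · refine regret_high_probability hn hT hμ hexp hlam hγ hδ0 hδ1 hrun
      (ℓ := fun t ω => payoffVec b (v t ω)) (fun t ht ω u => ?_) fun t ht ω u => ?_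
    · rw [hr t ht ω u, payoff_eq_dotProduct]
    · rw [hr t ht ω u]
      exact payoff_mem_Icc hb hsum u (v t ω)
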